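/- \textbf{Theorem.} There is an absolute constant $C$ such that the following holds. Let $A, B$ be finite sets, let $\Delta \ge 0$ be an integer, and let $f : A \times B \to \{0,1,\dots,\Delta\}$ be a function such that the real matrix $(f(a,b))_{a\in A,\, b\in B}$ has rank $r$. Then there is a deterministic two-party communication protocol that computes $f$ and whose length (the maximum, over all inputs $(a,b)$, of the number of bits exchanged) is at most $$C\cdot \Delta^{C\Delta}\cdot \sqrt{r}\cdot \log(\max\{r,2\}),$$ where $0^0 = 1$. In particular, for $r\ge 2$ the length is at most $\Delta^{O(\Delta)}\cdot\sqrt r\cdot\log r$. Here a deterministic protocol is a finite binary tree: each internal node is owned by Alice, who knows $a$, or Bob, who knows $b$; its owner sends one bit that depends only on the node and on the owner's input, and that bit selects the child to move to; each leaf is labelled with the output value. -/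

import Mathlib

/-- A deterministic two-party communication protocol on inputs `a : A` (Alice) and `b : B` (Bob)
with outputs in `Z`: a binary tree. At an internal node the player who owns it sends one bit,
which depends only on that player's input (and on the node, i.e. on the transcript so far); the
bit selects the subtree (`false`: first, `true`: second). A leaf carries the output, so that the
output is determined by the transcript alone. -/
inductive CommProtocol (A : Type*) (B : Type*) (Z : Type*)
  | output (z : Z) : CommProtocol A B Z
  | alice (msg : A → Bool) (p₀ p₁ : CommProtocol A B Z) : CommProtocol A B Z
  | bob (msg : B → Bool) (p₀ p₁ : CommProtocol A B Z) : CommProtocol A B Z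

namespace CommProtocol

/-- The output of the protocol on the input pair `(a, b)`. -/
def run {A B Z : Type*} : CommProtocol A B Z → A → B → Z
  | output z, _, _ => z
  | alice msg p₀ p₁, a, b => if msg a then p₁.run a b else p₀.run a b
  | bob msg p₀ p₁, a, b => if msg b then p₁.run a b else p₀.run a b

/-- The number of bits exchanged when the protocol is run on the input pair `(a, b)`. -/
def bits {A B Z : Type*} : CommProtocol A B Z → A → B → ℕ
  | output _, _, _ => 0
  | alice msg p₀ p₁, a, b => (if msg a then p₁.bits a b else p₀.bits a b) + 1
  | bob msg p₀ p₁, a, b => (if msg b then p₁.bits a b else p₀.bits a b) + 1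

/-- The length of a protocol: the maximum number of bits exchanged over all input pairs. -/
def length {A B Z : Type*} [Fintype A] [Fintype B] (p : CommProtocol A B Z) : ℕ :=
  Finset.univ.sup fun x : A × B => p.bits x.1 x.2

/-- The protocol computes `f`. -/
def Computes {A B Z : Type*} (p : CommProtocol A B Z) (f : A × B → Z) : Prop :=
  ∀ a b, p.run a b = f (a, b)

end CommProtocol

/-- The real matrix of values of `f : A × B → {0, 1, …, Δ}`. -/
def valueMatrix {A B : Type*} {Δ : ℕ} (f : A × B → Fin (Δ + 1)) : Matrix A B ℝ :=
  Matrix.of fun a b => ((f (a, b) : ℕ) : ℝ)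

/-!
Everything rests on finding, in a matrix with entries in `{0, …, Δ}` and rank `r`, a constant
rectangle of density `2 ^ (-O(Δ ^ 2 √r log r))`. A D-optimal design on the rows puts a rank
factorization into a position where the vectors of one side have norm at most `√r` and those of the
other norm at most `Δ`. After normalization, Gaussian rounding exhibits a function of the inner
product, with slope of order `1 / (Δ √r)` in the entries, as a mixture of rectangles; a power of
order `Δ √r log r` of it is again a mixture of rectangles and concentrates on the entries of largest
value, provided that they are not too rare. A rectangle on which all but a `1 / (4 r)` fraction of
the entries agree contains a large constant one. If the largest and the smallest value are both too
rare, the same rank argument, applied to a polynomial in the entries, removes them.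

Subtracting the constant makes the matrix vanish on the rectangle, so the rank drops to about a half
on its rows or on its columns. Removing these rows or columns over and over decomposes the matrix
into a grid of blocks of half the rank; the players exchange the labels of their block with
`O(Δ ^ 2 √r log r)` bits and recurse. The costs form a geometric series in `√r`.
-/

/-- The matrix `M` has rank at most `k` on the rectangle `X × Y`. The rank is encoded by a
factorization with inner dimension `k`, so that restricting to a subrectangle is immediate. -/
def RankLE {A B R : Type*} [CommSemiring R] (M : A → B → R) (X : Finset A) (Y : Finset B)
    (k : ℕ) : Prop :=
  ∃ (u : A → Fin k → R) (v : B → Fin k → R), ∀ i ∈ X, ∀ j ∈ Y, M i j = ∑ t, u i t * v j t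

namespace RankLE

open Module

variable {A B : Type*} {X X' : Finset A} {Y Y' : Finset B} {k l : ℕ}

section CommSemiring

variable {R : Type*} [CommSemiring R] {M N : A → B → R}

theorem mono (h : RankLE M X Y k) (hX : X' ⊆ X) (hY : Y' ⊆ Y) : RankLE M X' Y' k := by
  obtain ⟨u, v, h⟩ := h
  exact ⟨u, v, fun i hi j hj => h i (hX hi) j (hY hj)⟩

theorem congr (h : RankLE M X Y k) (e : ∀ i ∈ X, ∀ j ∈ Y, N i j = M i j) : RankLE N X Y k := by
  obtain ⟨u, v, h⟩ := h
  exact ⟨u, v, fun i hi j hj => (e i hi j hj).trans (h i hi j hj)⟩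

theorem transpose (h : RankLE M X Y k) : RankLE (fun j i => M i j) Y X k := by
  obtain ⟨u, v, h⟩ := h
  exact ⟨v, u, fun j hj i hi => by simp only [h i hi j hj, mul_comm]⟩

theorem of_sum {ι : Type*} [Fintype ι] (u : A → ι → R) (v : B → ι → R)
    (h : ∀ i ∈ X, ∀ j ∈ Y, M i j = ∑ t, u i t * v j t) (hk : Fintype.card ι ≤ k) :
    RankLE M X Y k := by
  let e : ι ↪ Fin k := (Fintype.equivFin ι).toEmbedding.trans (Fin.castLEEmb hk)
  refine ⟨fun i => Function.extend e (u i) 0, fun j => Function.extend e (v j) 0,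
    fun i hi j hj => (h i hi j hj).trans ?_⟩
  refine Fintype.sum_of_injective e e.injective _ _ (fun t ht => ?_) fun t => ?_
  · simp only [Function.extend_apply' _ _ _ ht, Pi.zero_apply, zero_mul]
  · simp only [e.injective.extend_apply]

theorem of_le (h : RankLE M X Y k) (hkl : k ≤ l) : RankLE M X Y l := by
  obtain ⟨u, v, h⟩ := h
  exact of_sum u v h (by simpa using hkl)

theorem const (a : R) : RankLE (fun _ _ => a) X Y 1 :=
  ⟨fun _ _ => a, fun _ _ => 1, fun _ _ _ _ => by simp⟩

theorem add (h : RankLE M X Y k) (h' : RankLE N X Y l) :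
    RankLE (fun i j => M i j + N i j) X Y (k + l) := by
  obtain ⟨u, v, h⟩ := h
  obtain ⟨u', v', h'⟩ := h'
  refine of_sum (ι := Fin k ⊕ Fin l) (fun i => Sum.elim (u i) (u' i))
    (fun j => Sum.elim (v j) (v' j)) (fun i hi j hj => ?_) (by simp)
  simp only [h i hi j hj, h' i hi j hj, Fintype.sum_sum_type, Sum.elim_inl, Sum.elim_inr]

theorem mul (h : RankLE M X Y k) (h' : RankLE N X Y l) :
    RankLE (fun i j => M i j * N i j) X Y (k * l) := by
  obtain ⟨u, v, h⟩ := h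
  obtain ⟨u', v', h'⟩ := h'
  refine of_sum (ι := Fin k × Fin l) (fun i t => u i t.1 * u' i t.2)
    (fun j t => v j t.1 * v' j t.2) (fun i hi j hj => ?_) (by simp)
  simp only [h i hi j hj, h' i hi j hj, Finset.sum_mul_sum, Fintype.sum_prod_type]
  exact Finset.sum_congr rfl fun _ _ => Finset.sum_congr rfl fun _ _ => mul_mul_mul_comm ..

theorem prod {ι : Type*} {N : ι → A → B → R} (s : Finset ι) (h : ∀ c ∈ s, RankLE (N c) X Y k) :
    RankLE (fun i j => ∏ c ∈ s, N c i j) X Y (k ^ s.card) := by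
  classical
  induction s using Finset.induction_on with
  | empty => simpa using const 1
  | insert c s hc ih =>
    rw [Finset.forall_mem_insert] at h
    simpa only [Finset.prod_insert hc, Finset.card_insert_of_notMem hc, pow_succ']
      using h.1.mul (ih h.2)

theorem affine (h : RankLE M X Y k) (a b : R) :
    RankLE (fun i j => a * M i j + b) X Y (k + 1) := by
  simpa only [one_mul] using ((const a).mul h).add (const b)

end CommSemiring

section Field

variable {K : Type*} [Field K] {M : A → B → K}

theorem of_mem_submodule {V : Type*} [AddCommGroup V] [Module K V] (W : Submodule K V)
    [FiniteDimensional K W] {u : A → V} {φ : B → Dual K V} (hu : ∀ i ∈ X, u i ∈ W)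
    (h : ∀ i ∈ X, ∀ j ∈ Y, M i j = φ j (u i)) : RankLE M X Y (finrank K W) := by
  choose! w hw using (fun i hi => ⟨⟨u i, hu i hi⟩, rfl⟩ : ∀ i ∈ X, ∃ w : W, (w : V) = u i)
  let b := finBasis K W
  refine of_sum (fun i => b.repr (w i)) (fun j t => φ j (b t)) (fun i hi j hj => ?_) (by simp)
  have hsum := congrArg (φ j ∘ₗ W.subtype) (b.sum_repr (w i))
  simp only [map_sum, map_smul, smul_eq_mul, LinearMap.comp_apply, W.subtype_apply] at hsum
  rw [h i hi j hj, ← hw i hi, hsum]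

theorem of_rank [Finite A] [Fintype B] (M : Matrix A B K) (X : Finset A) (Y : Finset B) :
    RankLE M X Y M.rank := by
  rw [M.rank_eq_finrank_span_row]
  exact of_mem_submodule (φ := fun j => LinearMap.proj j) _
    (fun i _ => Submodule.subset_span ⟨i, rfl⟩) fun _ _ _ _ => rfl

theorem exists_dual (h : RankLE M X Y k) :
    ∃ (u : A → Fin k → K) (φ : B → Dual K (Fin k → K)), ∀ i ∈ X, ∀ j ∈ Y, M i j = φ j (u i) := by
  obtain ⟨u, v, h⟩ := h
  refine ⟨u, fun j => dotProductEquiv K (Fin k) (v j), fun i hi j hj => ?_⟩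
  rw [h i hi j hj, dotProductEquiv_apply_apply, dotProduct_comm, dotProduct]

theorem split_of_zero (h : RankLE M X Y k) (hX : X' ⊆ X) (hY : Y' ⊆ Y)
    (h0 : ∀ i ∈ X', ∀ j ∈ Y', M i j = 0) :
    ∃ k₁ k₂, k₁ + k₂ ≤ k ∧ RankLE M X' Y k₁ ∧ RankLE M X Y' k₂ := by
  obtain ⟨u, φ, h⟩ := h.exists_dual
  let W := Submodule.span K (u '' X')
  have hφ : ∀ j ∈ Y', φ j ∈ W.dualAnnihilator := fun j hj => by
    rw [Submodule.mem_dualAnnihilator]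
    refine fun w hw => Submodule.span_induction ?_ (map_zero _)
      (fun x y _ _ hx hy => by rw [map_add, hx, hy, add_zero])
      (fun a x _ hx => by rw [map_smul, hx, smul_zero]) hw
    rintro _ ⟨i, hi, rfl⟩
    rw [← h i (hX hi) j (hY hj), h0 i hi j hj]
  refine ⟨finrank K W, finrank K W.dualAnnihilator, ?_, ?_, ?_⟩
  · rw [Subspace.finrank_add_finrank_dualAnnihilator_eq, finrank_fin_fun]
  · exact of_mem_submodule W (fun i hi => Submodule.subset_span ⟨i, hi, rfl⟩)
      fun i hi => h i (hX hi)
  · exact (of_mem_submodule (M := fun j i => M i j) (φ := fun i => Dual.eval K _ (u i)) _ hφ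
      fun j hj i hi => h i hi j (hY hj)).transpose

theorem exists_rows (h : RankLE M X Y k) :
    ∃ I ⊆ X, I.card ≤ k ∧ ∀ i ∈ X, ∃ c : A → K, ∀ j ∈ Y, M i j = ∑ t ∈ I, c t * M t j := by
  classical
  obtain ⟨u, φ, h⟩ := h.exists_dual
  obtain ⟨b, hbX, -, hspan, hind⟩ :=
    exists_linearIndepOn_extension (linearIndepOn_empty K u) (Set.empty_subset (X : Set A))
  lift b to Finset A using X.finite_toSet.subset hbX
  refine ⟨b, by exact_mod_cast hbX, ?_, fun i hi => ?_⟩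
  · simpa using hind.linearIndependent.fintype_card_le_finrank
  · obtain ⟨c, hc⟩ :=
      (Submodule.mem_span_image_finset_iff_exists_fun' K).1 (hspan ⟨i, hi, rfl⟩)
    refine ⟨c, fun j hj => ?_⟩
    rw [h i hi j hj, ← hc, map_sum]
    refine Finset.sum_congr rfl fun t ht => ?_
    rw [map_smul, smul_eq_mul, h t (hbX ht) j hj]

theorem exists_spanning (h : RankLE M X Y k) :
    ∃ l ≤ k, ∃ (u : A → Fin l → K) (v : B → Fin l → K),
      (∀ i ∈ X, ∀ j ∈ Y, M i j = ∑ t, u i t * v j t) ∧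
        Submodule.span K (Set.range fun i : X => u i) = ⊤ := by
  classical
  have hex : ∃ l, RankLE M X Y l := ⟨k, h⟩
  obtain ⟨u, v, huv⟩ := Nat.find_spec hex
  refine ⟨_, Nat.find_min' hex h, u, v, huv, ?_⟩
  refine Submodule.eq_top_of_finrank_eq (le_antisymm (Submodule.finrank_le _) ?_)
  rw [finrank_fin_fun]
  refine Nat.find_min' hex (of_mem_submodule
    (φ := fun j => dotProductEquiv K _ (v j)) _ (fun i hi => Submodule.subset_span ⟨⟨i, hi⟩, rfl⟩)
    fun i hi j hj => ?_)
  rw [huv i hi j hj, dotProductEquiv_apply_apply, dotProduct_comm, dotProduct]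

end Field

end RankLE

section QuadraticForms

open Matrix
open scoped RealInnerProductSpace

variable {n : Type*} [Fintype n]

theorem eq_zero_of_forall_dotProduct_eq_zero {ι : Type*} {u : ι → n → ℝ}
    (hu : Submodule.span ℝ (Set.range u) = ⊤) {x : n → ℝ} (h : ∀ i, u i ⬝ᵥ x = 0) : x = 0 := by
  classical
  have hx : dotProductEquiv ℝ n x = 0 := by
    refine LinearMap.ext_on_range hu fun i => ?_
    rw [dotProductEquiv_apply_apply, dotProduct_comm, h i, LinearMap.zero_apply]
  simpa using hx

open scoped MatrixOrder Matrix.Norms.L2Operator in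
theorem exists_eq_transpose_mul_of_posSemidef {S : Matrix n n ℝ} (hS : S.PosSemidef) :
    ∃ T : Matrix n n ℝ, S = Tᵀ * T := by
  classical
  obtain ⟨T, hT⟩ := CStarAlgebra.nonneg_iff_eq_star_mul_self.1 hS.nonneg
  exact ⟨T, by simpa [star_eq_conjTranspose] using hT⟩

variable [DecidableEq n]

theorem det_add_smul_vecMulVec {S : Matrix n n ℝ} (hS : IsUnit S.det) (t : ℝ) (x : n → ℝ) :
    (S + t • vecMulVec x x).det = S.det * (1 + t * (x ⬝ᵥ (S⁻¹ *ᵥ x))) := by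
  have hrank_one : t • vecMulVec x x = replicateCol Unit (t • x) * replicateRow Unit x := by
    rw [← vecMulVec_eq, smul_vecMulVec]
  rw [hrank_one, det_add_replicateCol_mul_replicateRow hS, det_unique (n := Unit),
    Matrix.add_apply, one_apply_eq, Matrix.mul_assoc, ← replicateCol_mulVec, mulVec_smul,
    mul_apply']
  change _ * (1 + x ⬝ᵥ (t • (S⁻¹ *ᵥ x))) = _
  rw [dotProduct_smul, smul_eq_mul]

theorem exists_inner_eq_dotProduct_of_posDef {S : Matrix n n ℝ} (hS : S.PosDef) :
    ∃ F G : (n → ℝ) → EuclideanSpace ℝ n, (∀ x y, ⟪F x, G y⟫ = x ⬝ᵥ y) ∧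
      (∀ x, ‖F x‖ ^ 2 = x ⬝ᵥ (S⁻¹ *ᵥ x)) ∧ ∀ y, ‖G y‖ ^ 2 = y ⬝ᵥ (S *ᵥ y) := by
  obtain ⟨T, hT⟩ := exists_eq_transpose_mul_of_posSemidef hS.posSemidef
  have hcancel : ∀ x, S *ᵥ (S⁻¹ *ᵥ x) = x := fun x => by
    rw [mulVec_mulVec, mul_nonsing_inv _ hS.det_pos.ne'.isUnit, one_mulVec]
  have hinner : ∀ x y, ⟪WithLp.toLp 2 (T *ᵥ x), WithLp.toLp 2 (T *ᵥ y)⟫ = (S *ᵥ x) ⬝ᵥ y := by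
    intro x y
    rw [EuclideanSpace.inner_toLp_toLp, star_trivial, dotProduct_comm, dotProduct_mulVec,
      ← mulVec_transpose, mulVec_mulVec, ← hT]
  refine ⟨fun x => WithLp.toLp 2 (T *ᵥ (S⁻¹ *ᵥ x)), fun y => WithLp.toLp 2 (T *ᵥ y),
    fun x y => ?_, fun x => ?_, fun y => ?_⟩
  · rw [hinner, hcancel]
  · rw [← real_inner_self_eq_norm_sq, hinner, hcancel]
  · rw [← real_inner_self_eq_norm_sq, hinner, dotProduct_comm]

end QuadraticForms

section OptimalDesign

open Matrix

variable {ι n : Type*} [Fintype ι]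

/-- The second-moment matrix of the vectors `u i` with weights `c i`. A weight on which its
determinant is maximal is a D-optimal design. -/
def secondMoment (u : ι → n → ℝ) (c : ι → ℝ) : Matrix n n ℝ :=
  ∑ i, c i • vecMulVec (u i) (u i)

theorem secondMoment_smul (u : ι → n → ℝ) (a : ℝ) (c : ι → ℝ) :
    secondMoment u (a • c) = a • secondMoment u c := by
  simp only [secondMoment, Finset.smul_sum, Pi.smul_apply, smul_assoc]

theorem secondMoment_add_smul_single [DecidableEq ι] (u : ι → n → ℝ) (c : ι → ℝ) (i : ι) (t : ℝ) :
    secondMoment u (c + t • Pi.single i 1) = secondMoment u c + t • vecMulVec (u i) (u i) := by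
  simp only [secondMoment, Pi.add_apply, add_smul, Finset.sum_add_distrib, Pi.smul_apply,
    Pi.single_apply, smul_eq_mul, mul_ite, mul_one, mul_zero, ite_smul, zero_smul,
    Finset.sum_ite_eq', Finset.mem_univ, if_true]

theorem dotProduct_secondMoment_mulVec [Fintype n] (u : ι → n → ℝ) (c : ι → ℝ) (x : n → ℝ) :
    x ⬝ᵥ (secondMoment u c *ᵥ x) = ∑ i, c i * (u i ⬝ᵥ x) ^ 2 := by
  rw [secondMoment, sum_mulVec, dotProduct_sum]
  refine Finset.sum_congr rfl fun i _ => ?_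
  rw [smul_mulVec, dotProduct_smul, vecMulVec_mulVec, op_smul_eq_smul, dotProduct_smul,
    dotProduct_comm x, smul_eq_mul, smul_eq_mul, sq]

theorem secondMoment_posSemidef [Finite n] (u : ι → n → ℝ) {c : ι → ℝ} (hc : ∀ i, 0 ≤ c i) :
    (secondMoment u c).PosSemidef :=
  posSemidef_sum _ fun i _ => (posSemidef_vecMulVec_self_star (u i)).smul (hc i)

theorem secondMoment_posDef [Finite n] {u : ι → n → ℝ} {c : ι → ℝ} (hc : ∀ i, 0 < c i)
    (hu : Submodule.span ℝ (Set.range u) = ⊤) : (secondMoment u c).PosDef := by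
  cases nonempty_fintype n
  have hterm : ∀ x i, 0 ≤ c i * (u i ⬝ᵥ x) ^ 2 := fun x i => mul_nonneg (hc i).le (sq_nonneg _)
  refine .of_dotProduct_mulVec_pos (secondMoment_posSemidef u fun i => (hc i).le).1 fun x hx => ?_
  rw [star_trivial, dotProduct_secondMoment_mulVec]
  refine (Finset.sum_nonneg fun i _ => hterm x i).lt_of_ne' fun h0 => hx ?_
  rw [Finset.sum_eq_zero_iff_of_nonneg fun i _ => hterm x i] at h0
  refine eq_zero_of_forall_dotProduct_eq_zero hu fun i => ?_
  simpa [(hc i).ne'] using h0 i (Finset.mem_univ i)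

theorem le_of_one_add_mul_le_pow {k : ℕ} {q : ℝ}
    (h : ∀ t : ℝ, 0 ≤ t → 1 + t * q ≤ (1 + t) ^ k) : q ≤ k := by
  have hderiv : HasDerivAt (fun t : ℝ => (1 + t) ^ k) k 0 := by
    simpa using ((hasDerivAt_id (0 : ℝ)).const_add 1).fun_pow k
  refine ge_of_tendsto hderiv.tendsto_slope_zero_right ?_
  filter_upwards [self_mem_nhdsWithin] with t ht
  have hht : 0 < t := ht
  rw [smul_eq_mul, le_inv_mul_iff₀ hht]
  simpa using sub_le_sub_right (h t hht.le) 1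

variable [Fintype n]

theorem exists_isMaxOn_det_secondMoment [Nonempty ι] [DecidableEq n] {u : ι → n → ℝ}
    (hu : Submodule.span ℝ (Set.range u) = ⊤) :
    ∃ c ∈ stdSimplex ℝ ι, (secondMoment u c).PosDef ∧
      IsMaxOn (fun c => (secondMoment u c).det) (stdSimplex ℝ ι) c := by
  classical
  have hcont : Continuous fun c : ι → ℝ => (secondMoment u c).det :=
    Continuous.matrix_det (by unfold secondMoment; fun_prop)
  obtain ⟨c, hc, hmax⟩ := (isCompact_stdSimplex ℝ ι).exists_isMaxOn
    ⟨_, single_mem_stdSimplex ℝ (Classical.arbitrary ι)⟩ hcont.continuousOn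
  have hcard : (0 : ℝ) < Fintype.card ι := by exact_mod_cast Fintype.card_pos
  have huniform : (fun _ : ι => (Fintype.card ι : ℝ)⁻¹) ∈ stdSimplex ℝ ι :=
    ⟨fun _ => by positivity, by simp [hcard.ne']⟩
  have hdet : 0 < (secondMoment u c).det :=
    (secondMoment_posDef (fun _ => by positivity) hu).det_pos.trans_le (hmax huniform)
  exact ⟨c, hc, (secondMoment_posSemidef u hc.1).posDef_iff_isUnit.2
    ((isUnit_iff_isUnit_det _).2 hdet.ne'.isUnit), hmax⟩

/-- **Kiefer–Wolfowitz**: at a D-optimal design, moving weight towards any `u i` cannot increase the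
determinant, and the derivative of the determinant in that direction gives the bound. -/
theorem exists_optimal_design [Nonempty ι] [DecidableEq n] {u : ι → n → ℝ}
    (hu : Submodule.span ℝ (Set.range u) = ⊤) :
    ∃ c ∈ stdSimplex ℝ ι, (secondMoment u c).PosDef ∧
      ∀ i, u i ⬝ᵥ ((secondMoment u c)⁻¹ *ᵥ u i) ≤ Fintype.card n := by
  classical
  obtain ⟨c, hc, hpos, hmax⟩ := exists_isMaxOn_det_secondMoment hu
  refine ⟨c, hc, hpos, fun i => le_of_one_add_mul_le_pow fun t ht => ?_⟩
  have : 0 < 1 + t := by linarith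
  have hmem : (1 + t)⁻¹ • (c + t • Pi.single i 1) ∈ stdSimplex ℝ ι := by
    rw [smul_add, smul_smul]
    exact convex_stdSimplex ℝ ι hc (single_mem_stdSimplex ℝ i) (by positivity) (by positivity)
      (by field_simp)
  have hle : (secondMoment u ((1 + t)⁻¹ • (c + t • Pi.single i 1))).det ≤ _ := hmax hmem
  rw [secondMoment_smul, secondMoment_add_smul_single, det_smul,
    det_add_smul_vecMulVec hpos.det_pos.ne'.isUnit, inv_pow, inv_mul_le_iff₀ (by positivity),
    mul_comm ((1 + t) ^ _)] at hle
  exact le_of_mul_le_mul_left hle hpos.det_pos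

end OptimalDesign

open Matrix in
open scoped RealInnerProductSpace in
theorem RankLE.exists_inner_norm_le {A B : Type*} {M : A → B → ℝ} {X : Finset A} {Y : Finset B}
    {r : ℕ} (h : RankLE M X Y r) {D : ℝ} (hD : 0 ≤ D) (hM : ∀ i ∈ X, ∀ j ∈ Y, |M i j| ≤ D) :
    ∃ (k : ℕ) (u : A → EuclideanSpace ℝ (Fin k)) (v : B → EuclideanSpace ℝ (Fin k)),
      (∀ i ∈ X, ‖u i‖ ≤ √r) ∧ (∀ j ∈ Y, ‖v j‖ ≤ D) ∧ ∀ i ∈ X, ∀ j ∈ Y, M i j = ⟪u i, v j⟫ := by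
  rcases X.eq_empty_or_nonempty with rfl | hX
  · exact ⟨0, 0, 0, by simp, by simp [hD], by simp⟩
  have : Nonempty X := hX.to_subtype
  obtain ⟨k, hk, u, v, huv, hspan⟩ := h.exists_spanning
  obtain ⟨c, hc, hpos, hq⟩ := exists_optimal_design hspan
  obtain ⟨F, G, hFG, hF, hG⟩ := exists_inner_eq_dotProduct_of_posDef hpos
  refine ⟨k, fun i => F (u i), fun j => G (v j), fun i hi => ?_, fun j hj => ?_,
    fun i hi j hj => by rw [hFG, huv i hi j hj, dotProduct]⟩
  · refine Real.le_sqrt_of_sq_le ?_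
    rw [hF]
    exact (hq ⟨i, hi⟩).trans (by simpa using hk)
  · refine le_of_sq_le_sq ?_ hD
    calc ‖G (v j)‖ ^ 2 = ∑ i : X, c i * (u i ⬝ᵥ v j) ^ 2 := by
          rw [hG, dotProduct_secondMoment_mulVec]
      _ ≤ ∑ i : X, c i * D ^ 2 := by
          refine Finset.sum_le_sum fun i _ => mul_le_mul_of_nonneg_left ?_ (hc.1 i)
          rw [dotProduct, ← huv i i.2 j hj]
          exact sq_le_sq.2 ((hM i i.2 j hj).trans (le_abs_self D))
      _ = D ^ 2 := by rw [← Finset.sum_mul, hc.2, one_mul]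

section GaussianRounding

open MeasureTheory ProbabilityTheory Real
open scoped RealInnerProductSpace

/-- The probability with which Gaussian rounding selects a pair of vectors of the unit ball whose
inner product is `t`; see `integral_roundingWeight_mul`. -/
noncomputable def sinhProb (t : ℝ) : ℝ :=
  (1 + exp (-1) * sinh t) / 4

theorem one_div_eight_le_sinhProb {t : ℝ} (ht : -1 ≤ t) : 1 / 8 ≤ sinhProb t := by
  have hexp : exp (-1) * exp 1 = 1 := by rw [← exp_add, neg_add_cancel, exp_zero]
  have hsinh : -((exp 1 - exp (-1)) / 2) ≤ sinh t := by
    rw [← sinh_eq, ← sinh_neg]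
    exact sinh_le_sinh.2 ht
  unfold sinhProb
  nlinarith [mul_le_mul_of_nonneg_left hsinh (exp_pos (-1)).le, sq_nonneg (exp (-1))]

theorem sinhProb_le_exp_neg_one {t : ℝ} (ht : t ≤ 1) : sinhProb t ≤ exp (-1) := by
  have hexp : exp (-1) * exp 1 = 1 := by rw [← exp_add, neg_add_cancel, exp_zero]
  have hsinh : sinh t ≤ (exp 1 - exp (-1)) / 2 := by
    rw [← sinh_eq]
    exact sinh_le_sinh.2 ht
  unfold sinhProb
  nlinarith [mul_le_mul_of_nonneg_left hsinh (exp_pos (-1)).le, exp_neg_one_gt_d9]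

theorem sinhProb_add_mul_sub_le {s t : ℝ} (hst : s ≤ t) :
    sinhProb s + exp (-1) / 4 * (t - s) ≤ sinhProb t := by
  have hsinh : sinh s - s ≤ sinh t - t := sinh_sub_id_strictMono.monotone hst
  unfold sinhProb
  linarith [mul_le_mul_of_nonneg_left hsinh (exp_pos (-1)).le]

variable {E : Type*} [NormedAddCommGroup E] [InnerProductSpace ℝ E]

/-- The weight that the direction `g` assigns to `u`; it lies in `[0, 1]` for `u` in the unit ball.
The exponential factor makes the mean of `roundingWeight u g * roundingWeight v g` depend on the
inner product of `u` and `v` only. -/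
noncomputable def roundingWeight (u g : E) : ℝ :=
  (1 + exp ((‖u‖ ^ 2 - 1) / 2) * sin ⟪g, u⟫) / 2

theorem roundingWeight_mem_Icc {u : E} (hu : ‖u‖ ≤ 1) (g : E) :
    roundingWeight u g ∈ Set.Icc (0 : ℝ) 1 := by
  have hexp : exp ((‖u‖ ^ 2 - 1) / 2) ≤ 1 := exp_le_one_iff.2 (by nlinarith [norm_nonneg u])
  have habs : |exp ((‖u‖ ^ 2 - 1) / 2) * sin ⟪g, u⟫| ≤ 1 := by
    rw [abs_mul, abs_exp]
    exact mul_le_one₀ hexp (abs_nonneg _) (abs_sin_le_one _)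
  rw [abs_le] at habs
  constructor <;> unfold roundingWeight <;> linarith

theorem roundingWeight_mul (u v g : E) :
    roundingWeight u g * roundingWeight v g =
      exp ((‖u‖ ^ 2 - 1) / 2) * exp ((‖v‖ ^ 2 - 1) / 2) / 4 * (sin ⟪g, u⟫ * sin ⟪g, v⟫) +
        (exp ((‖u‖ ^ 2 - 1) / 2) / 4 * sin ⟪g, u⟫ +
          (exp ((‖v‖ ^ 2 - 1) / 2) / 4 * sin ⟪g, v⟫ + 1 / 4)) := by
  unfold roundingWeight
  ring

variable [FiniteDimensional ℝ E] [MeasurableSpace E] [BorelSpace E]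

theorem integral_exp_inner_mul_I_stdGaussian (t : E) :
    ∫ g, Complex.exp (⟪g, t⟫ * Complex.I) ∂(stdGaussian E) = (exp (-‖t‖ ^ 2 / 2) : ℝ) := by
  rw [← charFun_apply, charFun_stdGaussian]
  push_cast
  rfl

theorem integrable_exp_inner_mul_I_stdGaussian (t : E) :
    Integrable (fun g : E => Complex.exp (⟪g, t⟫ * Complex.I)) (stdGaussian E) :=
  .of_bound (by fun_prop) 1 (.of_forall fun g => (Complex.norm_exp_ofReal_mul_I _).le)

theorem integral_cos_inner_stdGaussian (t : E) :
    ∫ g, cos ⟪g, t⟫ ∂(stdGaussian E) = exp (-‖t‖ ^ 2 / 2) := by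
  have h := integral_re (integrable_exp_inner_mul_I_stdGaussian t)
  simpa only [integral_exp_inner_mul_I_stdGaussian, RCLike.re_to_complex,
    Complex.exp_ofReal_mul_I_re, Complex.ofReal_re] using h

theorem integral_sin_inner_stdGaussian (t : E) :
    ∫ g, sin ⟪g, t⟫ ∂(stdGaussian E) = 0 := by
  have h := integral_im (integrable_exp_inner_mul_I_stdGaussian t)
  simpa only [integral_exp_inner_mul_I_stdGaussian, RCLike.im_to_complex,
    Complex.exp_ofReal_mul_I_im, Complex.ofReal_im] using h

theorem integrable_sin_inner_stdGaussian (t : E) :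
    Integrable (fun g : E => sin ⟪g, t⟫) (stdGaussian E) :=
  .of_bound (by fun_prop) 1 (.of_forall fun _ => abs_sin_le_one _)

theorem integrable_cos_inner_stdGaussian (t : E) :
    Integrable (fun g : E => cos ⟪g, t⟫) (stdGaussian E) :=
  .of_bound (by fun_prop) 1 (.of_forall fun _ => abs_cos_le_one _)

theorem integrable_sin_inner_mul_sin_inner_stdGaussian (u v : E) :
    Integrable (fun g : E => sin ⟪g, u⟫ * sin ⟪g, v⟫) (stdGaussian E) := by
  refine .of_bound (by fun_prop) 1 (.of_forall fun g => ?_)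
  rw [norm_mul]
  exact mul_le_one₀ (abs_sin_le_one _) (norm_nonneg _) (abs_sin_le_one _)

theorem integral_sin_inner_mul_sin_inner_stdGaussian (u v : E) :
    ∫ g, sin ⟪g, u⟫ * sin ⟪g, v⟫ ∂(stdGaussian E) =
      exp (-(‖u‖ ^ 2 + ‖v‖ ^ 2) / 2) * sinh ⟪u, v⟫ := by
  have hprod : ∀ g : E,
      sin ⟪g, u⟫ * sin ⟪g, v⟫ = (cos ⟪g, u - v⟫ - cos ⟪g, u + v⟫) / 2 := fun g => by
    rw [inner_sub_right, inner_add_right, cos_sub, cos_add]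
    ring
  simp only [hprod]
  rw [integral_div, integral_sub (integrable_cos_inner_stdGaussian _)
    (integrable_cos_inner_stdGaussian _), integral_cos_inner_stdGaussian,
    integral_cos_inner_stdGaussian, norm_sub_sq_real, norm_add_sq_real, sinh_eq, ← mul_div_assoc,
    mul_sub, ← exp_add, ← exp_add]
  ring_nf

theorem integrable_roundingWeight_mul (u v : E) :
    Integrable (fun g => roundingWeight u g * roundingWeight v g) (stdGaussian E) := by
  simp only [roundingWeight_mul]
  exact ((integrable_sin_inner_mul_sin_inner_stdGaussian u v).const_mul _).add
    (((integrable_sin_inner_stdGaussian u).const_mul _).add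
      (((integrable_sin_inner_stdGaussian v).const_mul _).add (integrable_const _)))

theorem integral_roundingWeight_mul (u v : E) :
    ∫ g, roundingWeight u g * roundingWeight v g ∂(stdGaussian E) = sinhProb ⟪u, v⟫ := by
  have huv := integrable_sin_inner_mul_sin_inner_stdGaussian u v
  have hu := integrable_sin_inner_stdGaussian u
  have hv := integrable_sin_inner_stdGaussian v
  have hnormalize : exp ((‖u‖ ^ 2 - 1) / 2) * exp ((‖v‖ ^ 2 - 1) / 2) *
      exp (-(‖u‖ ^ 2 + ‖v‖ ^ 2) / 2) = exp (-1) := by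
    rw [← exp_add, ← exp_add]
    ring_nf
  simp only [roundingWeight_mul]
  rw [integral_add (by fun_prop) (by fun_prop), integral_add (by fun_prop) (by fun_prop),
    integral_add (by fun_prop) (by fun_prop)]
  simp only [integral_const_mul, integral_sin_inner_stdGaussian, integral_const, probReal_univ,
    integral_sin_inner_mul_sin_inner_stdGaussian, smul_eq_mul]
  unfold sinhProb
  linear_combination sinh ⟪u, v⟫ / 4 * hnormalize

end GaussianRounding

theorem sum_mul_le_sum_filter_pos {ι : Type*} (s : Finset ι) (w x : ι → ℝ)
    (hx : ∀ i ∈ s, x i ∈ Set.Icc (0 : ℝ) 1) :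
    ∑ i ∈ s, w i * x i ≤ ∑ i ∈ s with 0 < w i, w i := by
  rw [Finset.sum_filter]
  refine Finset.sum_le_sum fun i hi => ?_
  obtain ⟨h0, h1⟩ := hx i hi
  split_ifs with hw
  · exact mul_le_of_le_one_right hw.le h1
  · exact mul_nonpos_of_nonpos_of_nonneg (not_lt.1 hw) h0

theorem sum_sum_ite_one_neg {A B : Type*} (X : Finset A) (Y : Finset B) {P : A → B → Prop}
    [∀ i j, Decidable (P i j)] (c : ℝ) : ∑ i ∈ X, ∑ j ∈ Y, (if P i j then 1 else -c) =
      X.card * Y.card - (c + 1) * {z ∈ X ×ˢ Y | ¬ P z.1 z.2}.card := by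
  have hcard : (X.card * Y.card : ℝ) = ∑ z ∈ X ×ˢ Y, 1 := by simp
  rw [← Finset.sum_boole, hcard, ← Finset.sum_product', Finset.mul_sum, ← Finset.sum_sub_distrib]
  refine Finset.sum_congr rfl fun z _ => ?_
  by_cases hP : P z.1 z.2 <;> simp [hP]

/-- `p` is dominated on `X × Y` by a mixture of indicators of subrectangles: every linear functional
`W` takes on some subrectangle a value at least as large as at `p`. By duality this says that some
convex combination of such indicators is equal to `p`. -/
def IsRectangleMixture {A B : Type*} (X : Finset A) (Y : Finset B) (p : A → B → ℝ) : Prop :=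
  ∀ W : A → B → ℝ, ∃ X' ⊆ X, ∃ Y' ⊆ Y,
    ∑ i ∈ X, ∑ j ∈ Y, W i j * p i j ≤ ∑ i ∈ X', ∑ j ∈ Y', W i j

namespace IsRectangleMixture

variable {A B : Type*} {X X' : Finset A} {Y Y' : Finset B} {p q : A → B → ℝ}

theorem one : IsRectangleMixture X Y (fun _ _ => 1) := fun _ =>
  ⟨X, subset_rfl, Y, subset_rfl, by simp only [mul_one, le_refl]⟩

theorem mono (hp : IsRectangleMixture X Y p) (hX : X' ⊆ X) (hY : Y' ⊆ Y) :
    IsRectangleMixture X' Y' p := by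
  classical
  intro W
  obtain ⟨X₁, -, Y₁, -, h⟩ := hp fun i j => if i ∈ X' then if j ∈ Y' then W i j else 0 else 0
  refine ⟨X₁ ∩ X', Finset.inter_subset_right, Y₁ ∩ Y', Finset.inter_subset_right, ?_⟩
  simpa only [ite_mul, zero_mul, Finset.sum_ite_irrel, Finset.sum_const_zero, Finset.sum_ite_mem,
    Finset.inter_eq_right.2 hX, Finset.inter_eq_right.2 hY] using h

theorem mul (hp : IsRectangleMixture X Y p) (hq : IsRectangleMixture X Y q) :
    IsRectangleMixture X Y (fun i j => p i j * q i j) := by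
  intro W
  obtain ⟨X₁, hX₁, Y₁, hY₁, h₁⟩ := hp fun i j => W i j * q i j
  obtain ⟨X₂, hX₂, Y₂, hY₂, h₂⟩ := hq.mono hX₁ hY₁ W
  refine ⟨X₂, hX₂.trans hX₁, Y₂, hY₂.trans hY₁, le_trans (le_of_eq ?_) (h₁.trans h₂)⟩
  exact Finset.sum_congr rfl fun _ _ => Finset.sum_congr rfl fun _ _ => by ring

theorem pow (hp : IsRectangleMixture X Y p) (n : ℕ) :
    IsRectangleMixture X Y (fun i j => p i j ^ n) := by
  induction n with
  | zero => simpa only [pow_zero] using one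
  | succ n ih => simpa only [pow_succ] using ih.mul hp

theorem of_fractional
    (h : ∀ W : A → B → ℝ, ∃ (x : A → ℝ) (y : B → ℝ), (∀ i ∈ X, x i ∈ Set.Icc (0 : ℝ) 1) ∧
      (∀ j ∈ Y, y j ∈ Set.Icc (0 : ℝ) 1) ∧
        ∑ i ∈ X, ∑ j ∈ Y, W i j * p i j ≤ ∑ i ∈ X, ∑ j ∈ Y, W i j * (x i * y j)) :
    IsRectangleMixture X Y p := by
  intro W
  obtain ⟨x, y, hx, hy, h⟩ := h W
  set X₁ := {i ∈ X | 0 < ∑ j ∈ Y, W i j * y j}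
  refine ⟨X₁, Finset.filter_subset _ _,
    {j ∈ Y | 0 < ∑ i ∈ X₁, W i j}, Finset.filter_subset _ _, ?_⟩
  calc ∑ i ∈ X, ∑ j ∈ Y, W i j * p i j
      ≤ ∑ i ∈ X, ∑ j ∈ Y, W i j * (x i * y j) := h
    _ = ∑ i ∈ X, (∑ j ∈ Y, W i j * y j) * x i := by
      simp only [Finset.sum_mul, mul_assoc, mul_comm (x _)]
    _ ≤ ∑ i ∈ X₁, ∑ j ∈ Y, W i j * y j := sum_mul_le_sum_filter_pos X _ x hx
    _ = ∑ j ∈ Y, (∑ i ∈ X₁, W i j) * y j := by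
      rw [Finset.sum_comm]
      simp only [Finset.sum_mul]
    _ ≤ ∑ j ∈ Y with 0 < ∑ i ∈ X₁, W i j, ∑ i ∈ X₁, W i j := sum_mul_le_sum_filter_pos Y _ y hy
    _ = _ := Finset.sum_comm

open MeasureTheory ProbabilityTheory in
open scoped RealInnerProductSpace in
theorem of_inner {E : Type*} [NormedAddCommGroup E] [InnerProductSpace ℝ E]
    [FiniteDimensional ℝ E] {u : A → E} {v : B → E} (hu : ∀ i ∈ X, ‖u i‖ ≤ 1)
    (hv : ∀ j ∈ Y, ‖v j‖ ≤ 1) (hp : ∀ i ∈ X, ∀ j ∈ Y, p i j = sinhProb ⟪u i, v j⟫) :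
    IsRectangleMixture X Y p := by
  borelize E
  refine of_fractional fun W => ?_
  have hint : ∀ i j, Integrable
      (fun g => W i j * (roundingWeight (u i) g * roundingWeight (v j) g)) (stdGaussian E) :=
    fun i j => (integrable_roundingWeight_mul (u i) (v j)).const_mul _
  have hint_sum : ∀ i, Integrable
      (fun g => ∑ j ∈ Y, W i j * (roundingWeight (u i) g * roundingWeight (v j) g))
        (stdGaussian E) := fun i => integrable_finsetSum _ fun j _ => hint i j
  obtain ⟨g, hg⟩ := exists_integral_le (integrable_finsetSum X fun i _ => hint_sum i)
  refine ⟨fun i => roundingWeight (u i) g, fun j => roundingWeight (v j) g,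
    fun i hi => roundingWeight_mem_Icc (hu i hi) g,
    fun j hj => roundingWeight_mem_Icc (hv j hj) g, le_trans (le_of_eq ?_) hg⟩
  rw [integral_finsetSum _ fun i _ => hint_sum i]
  refine Finset.sum_congr rfl fun i hi => ?_
  rw [integral_finsetSum _ fun j _ => hint i j]
  refine Finset.sum_congr rfl fun j hj => ?_
  rw [integral_const_mul, integral_roundingWeight_mul, hp i hi j hj]

section DenseRectangle

variable {P : A → B → Prop} [∀ i j, Decidable (P i j)] {d l : ℕ} {α : ℝ}

theorem le_two_pow_mul_sum_sum_ite (hα : 0 ≤ α)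
    (hon : ∀ i ∈ X, ∀ j ∈ Y, P i j → α ≤ p i j)
    (hoff : ∀ i ∈ X, ∀ j ∈ Y, ¬ P i j → 2 ^ (l + d + 1) * p i j ≤ α) :
    α * (2 ^ (d + 1) * {z ∈ X ×ˢ Y | P z.1 z.2}.card - X.card * Y.card) ≤
      2 ^ (d + 1) * ∑ i ∈ X, ∑ j ∈ Y, (if P i j then 1 else -2 ^ l) * p i j := by
  have hcard : (X.card * Y.card : ℝ) = ∑ z ∈ X ×ˢ Y, 1 := by simp
  rw [← Finset.sum_boole, hcard, ← Finset.sum_product', Finset.mul_sum, ← Finset.sum_sub_distrib,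
    Finset.mul_sum, Finset.mul_sum]
  refine Finset.sum_le_sum fun z hz => ?_
  obtain ⟨hi, hj⟩ := Finset.mem_product.1 hz
  by_cases hP : P z.1 z.2
  · have hscaled := mul_le_mul_of_nonneg_left (hon _ hi _ hj hP) (pow_nonneg zero_le_two (d + 1))
    simp only [hP, if_true]
    linarith
  · have hscaled := hoff _ hi _ hj hP
    rw [add_assoc, pow_add] at hscaled
    simp only [hP, if_false]
    linarith

theorem exists_dense_rectangle (hp : IsRectangleMixture X Y p) (hα : 0 ≤ α)
    (hon : ∀ i ∈ X, ∀ j ∈ Y, P i j → α ≤ p i j)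
    (hoff : ∀ i ∈ X, ∀ j ∈ Y, ¬ P i j → 2 ^ (l + d + 1) * p i j ≤ α)
    (hdense : X.card * Y.card ≤ 2 ^ d * {z ∈ X ×ˢ Y | P z.1 z.2}.card) :
    ∃ X' ⊆ X, ∃ Y' ⊆ Y,
      2 ^ l * {z ∈ X' ×ˢ Y' | ¬ P z.1 z.2}.card ≤ X'.card * Y'.card ∧
        α * (X.card * Y.card) ≤ 2 ^ (d + 1) * (X'.card * Y'.card) := by
  obtain ⟨X', hX', Y', hY', hsum⟩ := hp fun i j => if P i j then 1 else -2 ^ l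
  rw [sum_sum_ite_one_neg] at hsum
  set good := {z ∈ X ×ˢ Y | P z.1 z.2}.card
  set bad := {z ∈ X' ×ˢ Y' | ¬ P z.1 z.2}.card
  have hdense' : (X.card * Y.card : ℝ) ≤ 2 ^ d * good := by exact_mod_cast hdense
  have hmain : α * (X.card * Y.card) ≤ 2 ^ (d + 1) * (X'.card * Y'.card - (2 ^ l + 1) * bad) :=
    calc α * (X.card * Y.card)
        ≤ α * (2 ^ (d + 1) * good - X.card * Y.card) := by
          gcongr
          rw [pow_succ]
          linarith
      _ ≤ _ := le_two_pow_mul_sum_sum_ite hα hon hoff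
      _ ≤ _ := by gcongr
  refine ⟨X', hX', Y', hY', ?_, hmain.trans ?_⟩
  · have hnonneg : (0 : ℝ) ≤ X'.card * Y'.card - (2 ^ l + 1) * bad :=
      nonneg_of_mul_nonneg_right ((by positivity : 0 ≤ α * (X.card * Y.card)).trans hmain)
        (by positivity)
    have hle : (2 : ℝ) ^ l * bad ≤ X'.card * Y'.card := by
      linarith [Nat.cast_nonneg (α := ℝ) bad]
    exact_mod_cast hle
  · gcongr
    exact sub_le_self _ (by positivity)

end DenseRectangle

end IsRectangleMixture

theorem two_mul_pow_le_pow {n : ℕ} (hn : 0 < n) {p P : ℝ} (hp : 0 ≤ p)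
    (h : (n + 1) * p ≤ n * P) : 2 * p ^ n ≤ P ^ n := by
  have hn' : (0 : ℝ) < n := by exact_mod_cast hn
  have hbernoulli : 2 ≤ (1 + (n : ℝ)⁻¹) ^ n := by
    have := one_add_mul_le_pow (a := (n : ℝ)⁻¹) (by linarith [inv_pos.2 hn']) n
    rw [mul_inv_cancel₀ hn'.ne'] at this
    linarith
  calc 2 * p ^ n ≤ (1 + (n : ℝ)⁻¹) ^ n * p ^ n := by gcongr
    _ = ((1 + (n : ℝ)⁻¹) * p) ^ n := (mul_pow ..).symm
    _ ≤ P ^ n := by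
      gcongr
      rwa [← mul_le_mul_iff_right₀ hn', ← mul_assoc, mul_add, mul_one, mul_inv_cancel₀ hn'.ne']

open Real in
theorem two_pow_mul_sinhProb_pow_le {s : ℕ} (hs : 0 < s) (n : ℕ) {x y : ℝ} (hx : -s ≤ x)
    (hxy : x ≤ y - 1) (hy : y ≤ s) :
    2 ^ n * sinhProb (x / s) ^ (4 * s * n) ≤ sinhProb (y / s) ^ (4 * s * n) := by
  have hs' : (0 : ℝ) < s := by exact_mod_cast hs
  have hx1 : -1 ≤ x / s := by rwa [le_div_iff₀ hs', neg_one_mul]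
  have hx2 : x / s ≤ 1 := by rw [div_le_one hs']; linarith
  have hpos : 0 ≤ sinhProb (x / s) := by linarith [one_div_eight_le_sinhProb hx1]
  have hgap : sinhProb (x / s) + exp (-1) / (4 * s) ≤ sinhProb (y / s) := by
    have hdist : 1 ≤ y - x := by linarith
    refine le_trans ?_ (sinhProb_add_mul_sub_le
      (div_le_div_of_nonneg_right (by linarith : x ≤ y) hs'.le))
    rw [← sub_div, div_mul_div_comm]
    gcongr
    exact le_mul_of_one_le_right (exp_pos _).le hdist
  rw [pow_mul _ (4 * s) n, pow_mul _ (4 * s) n, ← mul_pow]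
  refine pow_le_pow_left₀ (by positivity) ?_ n
  refine two_mul_pow_le_pow (by positivity) hpos ?_
  have hscaled := mul_le_mul_of_nonneg_left hgap (by positivity : (0 : ℝ) ≤ 4 * s)
  rw [mul_add, mul_div_cancel₀ _ (by positivity)] at hscaled
  push_cast
  linarith [sinhProb_le_exp_neg_one hx2]

namespace RankLE

open Real

variable {A B : Type*} {M : A → B → ℝ} {X : Finset A} {Y : Finset B} {r : ℕ}

theorem isRectangleMixture_sinhProb (h : RankLE M X Y r) {D Q : ℝ} (hD : 0 < D) (hQ : 0 < Q)
    (hr : r ≤ Q ^ 2) (hM : ∀ i ∈ X, ∀ j ∈ Y, |M i j| ≤ D) :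
    IsRectangleMixture X Y fun i j => sinhProb (M i j / (D * Q)) := by
  obtain ⟨k, u, v, hu, hv, huv⟩ := h.exists_inner_norm_le hD.le hM
  refine .of_inner (u := fun i => Q⁻¹ • u i) (v := fun j => D⁻¹ • v j) (fun i hi => ?_)
    (fun j hj => ?_) fun i hi j hj => ?_
  · rw [norm_smul, norm_of_nonneg (inv_nonneg.2 hQ.le), inv_mul_le_iff₀ hQ, mul_one]
    exact (hu i hi).trans (sqrt_le_iff.2 ⟨hQ.le, hr⟩)
  · rw [norm_smul, norm_of_nonneg (inv_nonneg.2 hD.le), inv_mul_le_iff₀ hD, mul_one]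
    exact hv j hj
  · rw [real_inner_smul_left, real_inner_smul_right, ← huv i hi j hj]
    congr 1
    field_simp

/-- Raising the Gaussian rounding to a high power suppresses the entries below the top value `τ`. -/
theorem exists_amplified (h : RankLE M X Y r) {D Q d l : ℕ} {τ : ℝ} (hD : 0 < D) (hQ : 0 < Q)
    (hr : r ≤ Q ^ 2) (hM : ∀ i ∈ X, ∀ j ∈ Y, |M i j| ≤ D) (hτ : |τ| ≤ D)
    (hgap : ∀ i ∈ X, ∀ j ∈ Y, M i j = τ ∨ M i j ≤ τ - 1)
    (htop : X.card * Y.card ≤ 2 ^ d * {z ∈ X ×ˢ Y | M z.1 z.2 = τ}.card) :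
    ∃ X' ⊆ X, ∃ Y' ⊆ Y,
      2 ^ l * {z ∈ X' ×ˢ Y' | M z.1 z.2 ≠ τ}.card ≤ X'.card * Y'.card ∧
      X.card * Y.card ≤ 2 ^ (12 * (D * Q) * (l + d + 1) + d + 1) * (X'.card * Y'.card) := by
  have hs : 0 < D * Q := Nat.mul_pos hD hQ
  have hbound : ∀ {x : ℝ}, |x| ≤ D → -((D * Q : ℕ) : ℝ) ≤ x ∧ x ≤ ((D * Q : ℕ) : ℝ) := fun hx =>
    abs_le.1 (hx.trans (by exact_mod_cast Nat.le_mul_of_pos_right D hQ))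
  set T := 4 * (D * Q) * (l + d + 1) with hT
  have hmix := h.isRectangleMixture_sinhProb (D := D) (Q := Q) (by exact_mod_cast hD)
    (by exact_mod_cast hQ) (by exact_mod_cast hr) hM
  rw [← Nat.cast_mul] at hmix
  have hα : (1 / 8 : ℝ) ^ T ≤ sinhProb (τ / (D * Q : ℕ)) ^ T := by
    gcongr
    refine one_div_eight_le_sinhProb ?_
    rw [le_div_iff₀ (by exact_mod_cast hs), neg_one_mul]
    exact (hbound hτ).1
  obtain ⟨X', hX', Y', hY', hdense, hlarge⟩ := (hmix.pow T).exists_dense_rectangle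
    (P := fun i j => M i j = τ) ((by positivity : (0 : ℝ) ≤ (1 / 8) ^ T).trans hα)
    (fun i _ j _ hij => by rw [hij])
    (fun i hi j hj hij => two_pow_mul_sinhProb_pow_le hs _ (hbound (hM i hi j hj)).1
      ((hgap i hi j hj).resolve_left hij) (hbound hτ).2) htop
  refine ⟨X', hX', Y', hY', hdense, ?_⟩
  have hscaled : (1 / 8 : ℝ) ^ T * (X.card * Y.card) ≤ 2 ^ (d + 1) * (X'.card * Y'.card) :=
    (mul_le_mul_of_nonneg_right hα (by positivity)).trans hlarge
  rw [one_div, inv_pow, inv_mul_le_iff₀ (by positivity), ← mul_assoc,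
    show (8 : ℝ) = 2 ^ 3 by norm_num, ← pow_mul, ← pow_add] at hscaled
  rw [show 12 * (D * Q) * (l + d + 1) + d + 1 = 3 * T + (d + 1) by rw [hT]; ring]
  exact_mod_cast hscaled

end RankLE

theorem card_le_two_mul_card_filter_le {A : Type*} {X : Finset A} {n : A → ℕ} {m : ℕ}
    (h : 2 * ∑ i ∈ X, n i ≤ X.card * m) : X.card ≤ 2 * {i ∈ X | n i ≤ m}.card := by
  have hmarkov : {i ∈ X | ¬ n i ≤ m}.card * (m + 1) ≤ ∑ i ∈ X, n i :=
    calc {i ∈ X | ¬ n i ≤ m}.card * (m + 1) ≤ ∑ i ∈ X with ¬ n i ≤ m, n i :=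
          Finset.card_nsmul_le_sum _ n _ fun i hi => not_le.1 (Finset.mem_filter.1 hi).2
      _ ≤ _ := Finset.sum_le_sum_of_subset (Finset.filter_subset _ _)
  have hsplit := Finset.card_filter_add_card_filter_not (s := X) (fun i => n i ≤ m)
  by_contra! hlt
  nlinarith

namespace RankLE

section Field

variable {A B K : Type*} [Field K] [DecidableEq K] {X : Finset A} {Y : Finset B} {k : ℕ}

theorem exists_zero_rectangle {M : A → B → K} (h : RankLE M X Y k) (hk : 0 < k)
    (hs : 4 * k * {z ∈ X ×ˢ Y | M z.1 z.2 ≠ 0}.card ≤ X.card * Y.card) :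
    ∃ X' ⊆ X, ∃ Y' ⊆ Y, X.card ≤ 2 * X'.card ∧ Y.card ≤ 2 * Y'.card ∧
      ∀ i ∈ X', ∀ j ∈ Y', M i j = 0 := by
  classical
  set n : A → ℕ := fun i => {j ∈ Y | M i j ≠ 0}.card with hn
  have htotal : {z ∈ X ×ˢ Y | M z.1 z.2 ≠ 0}.card = ∑ i ∈ X, n i := by
    simp only [hn, Finset.card_filter, Finset.sum_product]
  set X' := {i ∈ X | 2 * k * n i ≤ Y.card}
  have hX'X : X' ⊆ X := Finset.filter_subset _ _
  have hX'card : X.card ≤ 2 * X'.card := by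
    refine card_le_two_mul_card_filter_le (le_trans (le_of_eq ?_) hs)
    rw [htotal, ← Finset.mul_sum]
    ring
  obtain ⟨I, hI, hIk, hrows⟩ := (h.mono hX'X subset_rfl).exists_rows
  set Y' := {j ∈ Y | ∀ i ∈ I, M i j = 0}
  refine ⟨X', hX'X, Y', Finset.filter_subset _ _, hX'card, ?_, fun i hi j hj => ?_⟩
  · have hunion : {j ∈ Y | ¬ ∀ i ∈ I, M i j = 0}.card ≤ ∑ i ∈ I, n i := by
      refine le_trans (Finset.card_le_card fun j hj => ?_) Finset.card_biUnion_le
      obtain ⟨hjY, hj⟩ := Finset.mem_filter.1 hj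
      push Not at hj
      obtain ⟨i, hi, hij⟩ := hj
      exact Finset.mem_biUnion.2 ⟨i, hi, Finset.mem_filter.2 ⟨hjY, hij⟩⟩
    have hsparse : k * (2 * ∑ i ∈ I, n i) ≤ k * Y.card :=
      calc k * (2 * ∑ i ∈ I, n i) = ∑ i ∈ I, 2 * k * n i := by rw [← Finset.mul_sum]; ring
        _ ≤ I.card * Y.card :=
          Finset.sum_le_card_nsmul _ _ _ fun i hi => (Finset.mem_filter.1 (hI hi)).2
        _ ≤ k * Y.card := by gcongr
    have hhalf := Nat.le_of_mul_le_mul_left hsparse hk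
    have hsplit : Y'.card + {j ∈ Y | ¬ ∀ i ∈ I, M i j = 0}.card = Y.card :=
      Finset.card_filter_add_card_filter_not (s := Y) (fun j => ∀ i ∈ I, M i j = 0)
    omega
  · obtain ⟨c, hc⟩ := hrows i hi
    obtain ⟨hjY, hj0⟩ := Finset.mem_filter.1 hj
    rw [hc j hjY]
    exact Finset.sum_eq_zero fun t ht => by rw [hj0 t ht, mul_zero]

theorem exists_rectangle_mem_of_sparse {M : A → B → K} (h : RankLE M X Y k) (T : Finset K)
    (hs : 4 * (k + 1) ^ T.card * {z ∈ X ×ˢ Y | M z.1 z.2 ∉ T}.card ≤ X.card * Y.card) :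
    ∃ X' ⊆ X, ∃ Y' ⊆ Y, X.card ≤ 2 * X'.card ∧ Y.card ≤ 2 * Y'.card ∧
      ∀ i ∈ X', ∀ j ∈ Y', M i j ∈ T := by
  have hprod : RankLE (fun i j => ∏ c ∈ T, (M i j - c)) X Y ((k + 1) ^ T.card) :=
    prod T fun c _ => (h.affine 1 (-c)).congr fun i _ j _ => by ring
  have hmem : ∀ x, ∏ c ∈ T, (x - c) = 0 ↔ x ∈ T := fun x => by
    simp only [Finset.prod_eq_zero_iff, sub_eq_zero, exists_eq_right']
  simpa only [hmem] using hprod.exists_zero_rectangle (by positivity) (by simpa only [ne_eq, hmem])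

theorem exists_rectangle_mem_erase {M : A → B → K} (h : RankLE M X Y k) {T : Finset K} {d : ℕ}
    {a b : K} (hM : ∀ i ∈ X, ∀ j ∈ Y, M i j ∈ T) (hd : 8 * (k + 1) ^ T.card ≤ 2 ^ d)
    (ha : 2 ^ d * {z ∈ X ×ˢ Y | M z.1 z.2 = a}.card ≤ X.card * Y.card)
    (hb : 2 ^ d * {z ∈ X ×ˢ Y | M z.1 z.2 = b}.card ≤ X.card * Y.card) :
    ∃ X' ⊆ X, ∃ Y' ⊆ Y, X.card ≤ 2 * X'.card ∧ Y.card ≤ 2 * Y'.card ∧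
      ∀ i ∈ X', ∀ j ∈ Y', M i j ∈ (T.erase a).erase b := by
  classical
  refine h.exists_rectangle_mem_of_sparse _ ?_
  have hbad : {z ∈ X ×ˢ Y | M z.1 z.2 ∉ (T.erase a).erase b}.card ≤
      {z ∈ X ×ˢ Y | M z.1 z.2 = a}.card + {z ∈ X ×ˢ Y | M z.1 z.2 = b}.card := by
    refine le_trans (Finset.card_le_card fun z hz => ?_) (Finset.card_union_le _ _)
    obtain ⟨hz, hnot⟩ := Finset.mem_filter.1 hz
    have hzT := hM z.1 (Finset.mem_product.1 hz).1 z.2 (Finset.mem_product.1 hz).2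
    simp only [Finset.mem_erase, not_and_or, not_not, hzT, not_true, or_false] at hnot
    simpa only [Finset.mem_union, Finset.mem_filter, hz, true_and] using hnot.symm
  have hpow : 8 * (k + 1) ^ ((T.erase a).erase b).card ≤ 2 ^ d := le_trans (by
    gcongr
    · exact Nat.le_add_left 1 k
    · exact (Finset.erase_subset _ _).trans (Finset.erase_subset _ _)) hd
  have hscaled := Nat.mul_le_mul hpow hbad
  rw [mul_add] at hscaled
  linarith

end Field

section Real

variable {A B : Type*} {M : A → B → ℝ} {X : Finset A} {Y : Finset B} {k D Q d lam : ℕ}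

theorem exists_top_rectangle (h : RankLE M X Y k) {τ : ℝ} (hD : 0 < D) (hQ : 0 < Q)
    (hkQ : k ≤ Q ^ 2) (hk : k + 1 ≤ 2 ^ lam) (hM : ∀ i ∈ X, ∀ j ∈ Y, |M i j| ≤ D)
    (hτ : |τ| ≤ D) (hgap : ∀ i ∈ X, ∀ j ∈ Y, M i j = τ ∨ M i j ≤ τ - 1)
    (htop : X.card * Y.card ≤ 2 ^ d * {z ∈ X ×ˢ Y | M z.1 z.2 = τ}.card) :
    ∃ X' ⊆ X, ∃ Y' ⊆ Y, (∀ i ∈ X', ∀ j ∈ Y', M i j = τ) ∧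
      X.card * Y.card ≤ 2 ^ (12 * (D * Q) * (lam + d + 3) + d + 3) * (X'.card * Y'.card) := by
  obtain ⟨X₁, hX₁, Y₁, hY₁, hsparse, hcard⟩ :=
    h.exists_amplified (l := lam + 2) hD hQ hkQ hM hτ hgap htop
  obtain ⟨X₂, hX₂, Y₂, hY₂, hXcard, hYcard, hconst⟩ :=
    (h.mono hX₁ hY₁).exists_rectangle_mem_of_sparse {τ} <| by
      simp only [Finset.card_singleton, pow_one, Finset.mem_singleton]
      refine le_trans (Nat.mul_le_mul_right _ ?_) hsparse
      rw [pow_add]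
      omega
  refine ⟨X₂, hX₂.trans hX₁, Y₂, hY₂.trans hY₁,
    fun i hi j hj => Finset.mem_singleton.1 (hconst i hi j hj), hcard.trans ?_⟩
  calc 2 ^ (12 * (D * Q) * (lam + 2 + d + 1) + d + 1) * (X₁.card * Y₁.card)
      ≤ 2 ^ (12 * (D * Q) * (lam + 2 + d + 1) + d + 1) * ((2 * X₂.card) * (2 * Y₂.card)) := by
        gcongr
    _ = _ := by ring

theorem exists_bottom_rectangle (h : RankLE M X Y k) {τ : ℝ} (hD : 0 < D) (hQ : 0 < Q)
    (hkQ : k ≤ Q ^ 2) (hk : k + 1 ≤ 2 ^ lam) (hM : ∀ i ∈ X, ∀ j ∈ Y, |M i j| ≤ D)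
    (hτ : |τ| ≤ D) (hgap : ∀ i ∈ X, ∀ j ∈ Y, M i j = τ ∨ τ + 1 ≤ M i j)
    (hbot : X.card * Y.card ≤ 2 ^ d * {z ∈ X ×ˢ Y | M z.1 z.2 = τ}.card) :
    ∃ X' ⊆ X, ∃ Y' ⊆ Y, (∀ i ∈ X', ∀ j ∈ Y', M i j = τ) ∧
      X.card * Y.card ≤ 2 ^ (12 * (D * Q) * (lam + d + 3) + d + 3) * (X'.card * Y'.card) := by
  have hneg : RankLE (fun i j => -M i j) X Y k := by
    simpa only [one_mul, neg_one_mul] using (const (-1)).mul h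
  simpa only [neg_inj] using hneg.exists_top_rectangle (τ := -τ) hD hQ hkQ hk
    (by simpa only [abs_neg] using hM) (by rwa [abs_neg])
    (fun i hi j hj => (hgap i hi j hj).imp neg_inj.2 fun hij => by linarith)
    (by simpa only [neg_inj] using hbot)

/-- Either an extreme value of `T` is dense, and amplification produces a constant rectangle, or
both are rare and can be removed from `T` at the cost of half of the rows and columns. -/
theorem exists_constant_rectangle_of_separated (hD : 0 < D) (hQ : 0 < Q) (hkQ : k ≤ Q ^ 2)
    (hk : k + 1 ≤ 2 ^ lam) (T : Finset ℝ) (hTD : ∀ a ∈ T, |a| ≤ D)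
    (hsep : ∀ a ∈ T, ∀ b ∈ T, a < b → a + 1 ≤ b) (hd : 8 * (k + 1) ^ T.card ≤ 2 ^ d)
    (h : RankLE M X Y k) (hM : ∀ i ∈ X, ∀ j ∈ Y, M i j ∈ T) :
    ∃ X' ⊆ X, ∃ Y' ⊆ Y, (∃ c, ∀ i ∈ X', ∀ j ∈ Y', M i j = c) ∧
      X.card * Y.card ≤
        2 ^ (12 * (D * Q) * (lam + d + 3) + d + 3 + 2 * T.card) * (X'.card * Y'.card) := by
  induction hn : T.card using Nat.strong_induction_on generalizing T X Y with
  | _ n ih =>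
  subst hn
  set e := 12 * (D * Q) * (lam + d + 3) + d + 3
  have hgrow : ∀ a : ℕ, 2 ^ e * a ≤ 2 ^ (e + 2 * T.card) * a := fun a => by
    gcongr
    · exact one_le_two
    · exact Nat.le_add_right _ _
  have hMD : ∀ i ∈ X, ∀ j ∈ Y, |M i j| ≤ D := fun i hi j hj => hTD _ (hM i hi j hj)
  obtain rfl | hT := T.eq_empty_or_nonempty
  · refine ⟨X, subset_rfl, Y, subset_rfl,
      ⟨0, fun i hi j hj => absurd (hM i hi j hj) (Finset.notMem_empty _)⟩, ?_⟩
    exact Nat.le_mul_of_pos_left _ (by positivity)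
  by_cases htop : X.card * Y.card ≤ 2 ^ d * {z ∈ X ×ˢ Y | M z.1 z.2 = T.max' hT}.card
  · obtain ⟨X', hX', Y', hY', hconst, hcard⟩ := h.exists_top_rectangle hD hQ hkQ hk hMD
      (hTD _ (T.max'_mem hT)) (fun i hi j hj => (T.le_max' _ (hM i hi j hj)).eq_or_lt.imp_right
        fun hlt => le_sub_iff_add_le.2 (hsep _ (hM i hi j hj) _ (T.max'_mem hT) hlt)) htop
    exact ⟨X', hX', Y', hY', ⟨_, hconst⟩, hcard.trans (hgrow _)⟩
  by_cases hbot : X.card * Y.card ≤ 2 ^ d * {z ∈ X ×ˢ Y | M z.1 z.2 = T.min' hT}.card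
  · obtain ⟨X', hX', Y', hY', hconst, hcard⟩ := h.exists_bottom_rectangle hD hQ hkQ hk hMD
      (hTD _ (T.min'_mem hT)) (fun i hi j hj => (T.min'_le _ (hM i hi j hj)).eq_or_lt.imp Eq.symm
        (hsep _ (T.min'_mem hT) _ (hM i hi j hj))) hbot
    exact ⟨X', hX', Y', hY', ⟨_, hconst⟩, hcard.trans (hgrow _)⟩
  obtain ⟨X₁, hX₁, Y₁, hY₁, hXcard, hYcard, hmem⟩ :=
    h.exists_rectangle_mem_erase hM hd (not_le.1 htop).le (not_le.1 hbot).le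
  set T' := (T.erase (T.max' hT)).erase (T.min' hT)
  have hT'T : T' ⊆ T := (Finset.erase_subset _ _).trans (Finset.erase_subset _ _)
  have hT'card : T'.card < T.card :=
    Finset.card_erase_le.trans_lt (Finset.card_erase_lt_of_mem (T.max'_mem hT))
  obtain ⟨X', hX', Y', hY', hconst, hcard⟩ := ih _ hT'card T' (fun a ha => hTD a (hT'T ha))
    (fun a ha b hb => hsep a (hT'T ha) b (hT'T hb))
    (le_trans (by gcongr; exact Nat.le_add_left 1 k) hd) (h.mono hX₁ hY₁) hmem rfl
  refine ⟨X', hX'.trans hX₁, Y', hY'.trans hY₁, hconst, ?_⟩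
  calc X.card * Y.card ≤ (2 * X₁.card) * (2 * Y₁.card) := Nat.mul_le_mul hXcard hYcard
    _ = 4 * (X₁.card * Y₁.card) := by ring
    _ ≤ 4 * (2 ^ (e + 2 * T'.card) * (X'.card * Y'.card)) := Nat.mul_le_mul_left _ hcard
    _ = 2 ^ (e + 2 * T'.card + 2) * (X'.card * Y'.card) := by ring
    _ ≤ _ := Nat.mul_le_mul_right _ (Nat.pow_le_pow_right (by norm_num) (by omega))

theorem exists_constant_rectangle {f : A → B → ℕ} (hD : 0 < D) (hQ : 0 < Q) (hlam : 0 < lam)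
    (hkQ : k ≤ Q ^ 2) (hk : k + 1 ≤ 2 ^ lam) (h : RankLE (fun i j => (f i j : ℝ)) X Y k)
    (hf : ∀ i ∈ X, ∀ j ∈ Y, f i j ≤ D) :
    ∃ X' ⊆ X, ∃ Y' ⊆ Y, (∃ c, ∀ i ∈ X', ∀ j ∈ Y', f i j = c) ∧
      X.card * Y.card ≤ 2 ^ (120 * (D ^ 2 * lam) * Q) * (X'.card * Y'.card) := by
  set T : Finset ℝ := (Finset.range (D + 1)).image (↑) with hT
  have hTcard : T.card = D + 1 := by
    rw [hT, Finset.card_image_of_injective _ Nat.cast_injective, Finset.card_range]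
  have hd : 8 * (k + 1) ^ T.card ≤ 2 ^ (lam * (D + 1) + 3) := by
    rw [hTcard, pow_add 2, pow_mul, mul_comm]
    gcongr
    norm_num
  obtain ⟨X', hX', Y', hY', ⟨c, hconst⟩, hcard⟩ :=
    exists_constant_rectangle_of_separated hD hQ hkQ hk T
      (by
        simp only [hT, Finset.forall_mem_image, Finset.mem_range, Nat.abs_cast, Nat.cast_le]
        omega)
      (by simp only [hT, Finset.forall_mem_image]; exact_mod_cast fun a _ b _ hab => hab) hd h
      (fun i hi j hj => Finset.mem_image_of_mem _ (Finset.mem_range_succ_iff.2 (hf i hi j hj)))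
  refine ⟨X', hX', Y', hY', ?_, hcard.trans ?_⟩
  · obtain rfl | ⟨i₀, hi₀⟩ := X'.eq_empty_or_nonempty
    · exact ⟨0, by simp⟩
    obtain rfl | ⟨j₀, hj₀⟩ := Y'.eq_empty_or_nonempty
    · exact ⟨0, by simp⟩
    exact ⟨f i₀ j₀, fun i hi j hj =>
      Nat.cast_injective ((hconst i hi j hj).trans (hconst i₀ hi₀ j₀ hj₀).symm)⟩
  · rw [hTcard]
    gcongr
    · exact one_le_two
    · have hlamD : lam ≤ D * lam := Nat.le_mul_of_pos_left _ hD
      have hDlam : D ≤ D * lam := Nat.le_mul_of_pos_right _ hlam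
      have hDQ : D * lam ≤ D * lam * (D * Q) := Nat.le_mul_of_pos_right _ (Nat.mul_pos hD hQ)
      calc 12 * (D * Q) * (lam + (lam * (D + 1) + 3) + 3) + (lam * (D + 1) + 3) + 3 + 2 * (D + 1)
          ≤ 12 * (D * Q) * (9 * (D * lam)) + 12 * (D * lam * (D * Q)) := by
            rw [add_assoc, add_assoc]
            gcongr <;> linarith
        _ = _ := by ring

end Real

end RankLE

namespace CommProtocol

variable {A B A₁ B₁ Z : Type*}

/-- Exchange the roles of Alice and Bob. -/
def swap : CommProtocol A B Z → CommProtocol B A Z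
  | output z => output z
  | alice msg p₀ p₁ => bob msg p₀.swap p₁.swap
  | bob msg p₀ p₁ => alice msg p₀.swap p₁.swap

theorem run_swap (p : CommProtocol A B Z) (a : A) (b : B) : p.swap.run b a = p.run a b := by
  induction p with
  | output => rfl
  | alice _ _ _ h₀ h₁ => simp only [swap, run, h₀, h₁]
  | bob _ _ _ h₀ h₁ => simp only [swap, run, h₀, h₁]

theorem bits_swap (p : CommProtocol A B Z) (a : A) (b : B) : p.swap.bits b a = p.bits a b := by
  induction p with
  | output => rfl
  | alice _ _ _ h₀ h₁ => simp only [swap, bits, h₀, h₁]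
  | bob _ _ _ h₀ h₁ => simp only [swap, bits, h₀, h₁]

/-- Both players apply a map to their input before they run the protocol. -/
def comap (φ : A₁ → A) (ψ : B₁ → B) : CommProtocol A B Z → CommProtocol A₁ B₁ Z
  | output z => output z
  | alice msg p₀ p₁ => alice (msg ∘ φ) (p₀.comap φ ψ) (p₁.comap φ ψ)
  | bob msg p₀ p₁ => bob (msg ∘ ψ) (p₀.comap φ ψ) (p₁.comap φ ψ)

theorem run_comap (φ : A₁ → A) (ψ : B₁ → B) (p : CommProtocol A B Z) (a : A₁) (b : B₁) :
    (p.comap φ ψ).run a b = p.run (φ a) (ψ b) := by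
  induction p with
  | output => rfl
  | alice _ _ _ h₀ h₁ => simp only [comap, run, h₀, h₁, Function.comp]
  | bob _ _ _ h₀ h₁ => simp only [comap, run, h₀, h₁, Function.comp]

theorem bits_comap (φ : A₁ → A) (ψ : B₁ → B) (p : CommProtocol A B Z) (a : A₁) (b : B₁) :
    (p.comap φ ψ).bits a b = p.bits (φ a) (ψ b) := by
  induction p with
  | output => rfl
  | alice _ _ _ h₀ h₁ => simp only [comap, bits, h₀, h₁, Function.comp]
  | bob _ _ _ h₀ h₁ => simp only [comap, bits, h₀, h₁, Function.comp]

end CommProtocol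

theorem exists_injOn_lt_of_card_le {α : Type*} {s : Finset α} {N : ℕ} (hs : s.card ≤ N) :
    ∃ t : α → ℕ, (∀ a ∈ s, t a < N) ∧ Set.InjOn t s := by
  have hcard : (s : Set α).encard ≤ ((Finset.range N : Finset ℕ) : Set ℕ).encard := by
    rw [Set.encard_coe_eq_coe_finsetCard, Set.encard_coe_eq_coe_finsetCard, Finset.card_range]
    exact_mod_cast hs
  obtain ⟨t, ht, hinj⟩ := s.finite_toSet.exists_injOn_of_encard_le hcard
  exact ⟨t, fun a ha => Finset.mem_range.1 (ht ha), hinj⟩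

/-- Some protocol computes `f` on the rectangle `X × Y` with at most `c` bits. Nothing is required
of its behaviour outside of `X × Y`. -/
def SolvableOn {A B Z : Type*} (f : A × B → Z) (X : Finset A) (Y : Finset B) (c : ℕ) : Prop :=
  ∃ p : CommProtocol A B Z, ∀ a ∈ X, ∀ b ∈ Y, p.run a b = f (a, b) ∧ p.bits a b ≤ c

namespace SolvableOn

variable {A B Z : Type*} {f : A × B → Z} {X X' : Finset A} {Y Y' : Finset B} {c c' m n : ℕ}

theorem mono (h : SolvableOn f X Y c) (hX : X' ⊆ X) (hY : Y' ⊆ Y) (hc : c ≤ c') :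
    SolvableOn f X' Y' c' := by
  obtain ⟨p, hp⟩ := h
  exact ⟨p, fun a ha b hb => (hp a (hX ha) b (hY hb)).imp_right hc.trans'⟩

theorem of_const {z : Z} (h : ∀ a ∈ X, ∀ b ∈ Y, f (a, b) = z) : SolvableOn f X Y 0 :=
  ⟨.output z, fun a ha b hb => ⟨(h a ha b hb).symm, le_rfl⟩⟩

theorem transpose (h : SolvableOn f X Y c) : SolvableOn (f ∘ Prod.swap) Y X c := by
  obtain ⟨p, hp⟩ := h
  refine ⟨p.swap, fun b hb a ha => ?_⟩
  rw [p.run_swap, p.bits_swap]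
  exact hp a ha b hb

theorem of_retract (h : SolvableOn f X' Y' c) (ρ : A → A) (σ : B → B)
    (hρ : ∀ a ∈ X, ρ a ∈ X') (hσ : ∀ b ∈ Y, σ b ∈ Y')
    (hf : ∀ a ∈ X, ∀ b ∈ Y, f (ρ a, σ b) = f (a, b)) : SolvableOn f X Y c := by
  obtain ⟨p, hp⟩ := h
  refine ⟨p.comap ρ σ, fun a ha b hb => ?_⟩
  rw [p.run_comap, p.bits_comap, ← hf a ha b hb]
  exact hp _ (hρ a ha) _ (hσ b hb)

theorem alice_bit (P : A → Prop) [DecidablePred P] (h₁ : SolvableOn f {a ∈ X | P a} Y c)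
    (h₀ : SolvableOn f {a ∈ X | ¬ P a} Y c) : SolvableOn f X Y (c + 1) := by
  obtain ⟨p₁, hp₁⟩ := h₁
  obtain ⟨p₀, hp₀⟩ := h₀
  refine ⟨.alice (fun a => decide (P a)) p₀ p₁, fun a ha b hb => ?_⟩
  simp only [CommProtocol.run, CommProtocol.bits, decide_eq_true_eq, Nat.add_le_add_iff_right]
  by_cases hP : P a
  · simpa only [hP, if_true] using hp₁ a (Finset.mem_filter.2 ⟨ha, hP⟩) b hb
  · simpa only [hP, if_false] using hp₀ a (Finset.mem_filter.2 ⟨ha, hP⟩) b hb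

theorem alice_send (t : A → ℕ) (ht : ∀ a ∈ X, t a < 2 ^ m)
    (h : ∀ i, SolvableOn f {a ∈ X | t a = i} Y c) : SolvableOn f X Y (c + m) := by
  induction m generalizing X t with
  | zero =>
    refine (h 0).mono (fun a ha => Finset.mem_filter.2 ⟨ha, ?_⟩) subset_rfl le_rfl
    simpa only [pow_zero, Nat.lt_one_iff] using ht a ha
  | succ m ih =>
    refine alice_bit (fun a => t a < 2 ^ m) (ih t (fun a ha => (Finset.mem_filter.1 ha).2) ?_)
      (ih (fun a => t a - 2 ^ m) (fun a ha => ?_) ?_)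
    · exact fun i => (h i).mono (Finset.filter_subset_filter _ (Finset.filter_subset _ _))
        subset_rfl le_rfl
    · have hlt := ht a (Finset.mem_filter.1 ha).1
      have := Nat.two_pow_pos m
      omega
    · refine fun i => (h (i + 2 ^ m)).mono (fun a ha => ?_) subset_rfl le_rfl
      simp only [Finset.mem_filter] at ha ⊢
      exact ⟨ha.1.1, by omega⟩

theorem bob_send (t : B → ℕ) (ht : ∀ b ∈ Y, t b < 2 ^ m)
    (h : ∀ i, SolvableOn f X {b ∈ Y | t b = i} c) : SolvableOn f X Y (c + m) :=
  (alice_send t ht fun i => (h i).transpose).transpose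

theorem both_send (s : A → ℕ) (t : B → ℕ) (hs : ∀ a ∈ X, s a < 2 ^ m) (ht : ∀ b ∈ Y, t b < 2 ^ n)
    (h : ∀ i j, SolvableOn f {a ∈ X | s a = i} {b ∈ Y | t b = j} c) :
    SolvableOn f X Y (c + n + m) :=
  alice_send s hs fun i => bob_send t ht (h i)

theorem of_card [Nonempty Z] (hX : X.card ≤ 2 ^ m) (hY : Y.card ≤ 2 ^ n) :
    SolvableOn f X Y (n + m) := by
  obtain ⟨s, hs, hs_inj⟩ := exists_injOn_lt_of_card_le hX
  obtain ⟨t, ht, ht_inj⟩ := exists_injOn_lt_of_card_le hY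
  rw [← zero_add n]
  refine both_send s t hs ht fun i j => ?_
  obtain hempty | ⟨a, ha⟩ := {a ∈ X | s a = i}.eq_empty_or_nonempty
  · exact of_const (z := Classical.arbitrary Z) (by simp [hempty])
  obtain hempty | ⟨b, hb⟩ := {b ∈ Y | t b = j}.eq_empty_or_nonempty
  · exact of_const (z := Classical.arbitrary Z) (by simp [hempty])
  rw [Finset.mem_filter] at ha hb
  refine of_const (z := f (a, b)) fun a' ha' b' hb' => ?_
  rw [Finset.mem_filter] at ha' hb'
  rw [hs_inj ha'.1 ha.1 (ha'.2.trans ha.2.symm), ht_inj hb'.1 hb.1 (hb'.2.trans hb.2.symm)]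

end SolvableOn

/-- Labels `0, …, n` of the rows and of the columns decompose `X × Y` into rectangles that all
satisfy `good`. Both players can read off their label without communication. -/
def HasGrid {A B : Type*} (good : Finset A → Finset B → Prop) (n : ℕ) (X : Finset A)
    (Y : Finset B) : Prop :=
  ∃ (s : A → ℕ) (t : B → ℕ), (∀ a ∈ X, s a ≤ n) ∧ (∀ b ∈ Y, t b ≤ n) ∧
    ∀ i j, good {a ∈ X | s a = i} {b ∈ Y | t b = j}

theorem two_mul_pred_pow_lt {q : ℕ} (hq : 0 < q) : 2 * (q - 1) ^ q < q ^ q := by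
  obtain ⟨p, rfl⟩ := Nat.exists_eq_succ_of_ne_zero hq.ne'
  obtain rfl | hp := p.eq_zero_or_pos
  · norm_num
  have hle : 2 * p ^ p ≤ (p + 1) ^ p := by
    exact_mod_cast two_mul_pow_le_pow hp (Nat.cast_nonneg p) (P := p + 1) (mul_comm _ _).le
  calc 2 * p ^ (p + 1) = 2 * p ^ p * p := by ring
    _ < (p + 1) ^ p * (p + 1) := Nat.mul_lt_mul_of_le_of_lt hle p.lt_succ_self (by positivity)

theorem mul_pred_pow_lt {q g a : ℕ} (hq : 0 < q) (hg : 0 < g) (ha : a ≤ 2 ^ g) :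
    a * (q - 1) ^ (q * g) < q ^ (q * g) :=
  calc a * (q - 1) ^ (q * g) ≤ 2 ^ g * (q - 1) ^ (q * g) := Nat.mul_le_mul_right _ ha
    _ = (2 * (q - 1) ^ q) ^ g := by rw [mul_pow, pow_mul]
    _ < (q ^ q) ^ g := Nat.pow_lt_pow_left (two_mul_pred_pow_lt hq) hg.ne'
    _ = _ := by rw [pow_mul]

theorem sub_mul_pred_pow_lt {q n a a' b : ℕ} (ha : a ≤ q * a')
    (h : a * b * (q - 1) ^ (n + 1) < q ^ (n + 1)) : (a - a') * b * (q - 1) ^ n < q ^ n := by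
  have hshrink : q * (a - a') ≤ a * (q - 1) := by
    rw [Nat.mul_sub, Nat.mul_sub, mul_one, mul_comm a]
    omega
  refine lt_of_mul_lt_mul_left (a := q) ?_ (Nat.zero_le _)
  calc q * ((a - a') * b * (q - 1) ^ n) = q * (a - a') * (b * (q - 1) ^ n) := by ring
    _ ≤ a * (q - 1) * (b * (q - 1) ^ n) := Nat.mul_le_mul_right _ hshrink
    _ = a * b * (q - 1) ^ (n + 1) := by ring
    _ < q ^ (n + 1) := h
    _ = q * q ^ n := by ring

namespace HasGrid

variable {A B : Type*} {good : Finset A → Finset B → Prop} {X X' : Finset A} {Y Y' : Finset B}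
  {n q : ℕ}

theorem swap (h : HasGrid (fun Y X => good X Y) n Y X) : HasGrid good n X Y := by
  obtain ⟨t, s, ht, hs, hst⟩ := h
  exact ⟨s, t, hs, ht, fun i j => hst j i⟩

theorem insert_rows [DecidableEq A]
    (hmono : ∀ {X X' Y Y'}, X' ⊆ X → Y' ⊆ Y → good X Y → good X' Y')
    (h : HasGrid good n (X \ X') Y) (hX' : good X' Y) : HasGrid good (n + 1) X Y := by
  obtain ⟨s, t, hs, ht, hst⟩ := h
  refine ⟨fun a => if a ∈ X' then 0 else s a + 1, t, fun a ha => ?_,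
    fun b hb => (ht b hb).trans n.le_succ, fun i j => ?_⟩
  · by_cases haX' : a ∈ X'
    · simp only [haX', if_true, Nat.zero_le]
    · simpa only [haX', if_false, Nat.add_le_add_iff_right] using
        hs a (Finset.mem_sdiff.2 ⟨ha, haX'⟩)
  · cases i with
    | zero =>
      refine hmono (fun a ha => ?_) (Finset.filter_subset _ _) hX'
      simpa using (Finset.mem_filter.1 ha).2
    | succ i =>
      refine hmono (fun a ha => ?_) subset_rfl (hst i j)
      obtain ⟨haX, ha⟩ := Finset.mem_filter.1 ha
      by_cases haX' : a ∈ X'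
      · simp [haX'] at ha
      · simpa [haX, haX'] using ha

theorem insert_columns [DecidableEq B]
    (hmono : ∀ {X X' Y Y'}, X' ⊆ X → Y' ⊆ Y → good X Y → good X' Y')
    (h : HasGrid good n X (Y \ Y')) (hY' : good X Y') : HasGrid good (n + 1) X Y :=
  (h.swap.insert_rows (good := fun Y X => good X Y) (fun hY hX => hmono hX hY) hY').swap

theorem of_dense_split (hmono : ∀ {X X' Y Y'}, X' ⊆ X → Y' ⊆ Y → good X Y → good X' Y')
    (hempty : ∀ {X Y}, X = ∅ ∨ Y = ∅ → good X Y)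
    (hsplit : ∀ X₁ ⊆ X, ∀ Y₁ ⊆ Y,
      (∃ X₂ ⊆ X₁, good X₂ Y₁ ∧ X₁.card ≤ q * X₂.card) ∨
        ∃ Y₂ ⊆ Y₁, good X₁ Y₂ ∧ Y₁.card ≤ q * Y₂.card)
    (h : X.card * Y.card * (q - 1) ^ n < q ^ n) : HasGrid good n X Y := by
  classical
  induction n generalizing X Y with
  | zero =>
    have hXY : X = ∅ ∨ Y = ∅ := by simpa using h
    exact ⟨0, 0, by simp, by simp, fun _ _ =>
      hmono (Finset.filter_subset _ _) (Finset.filter_subset _ _) (hempty hXY)⟩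
  | succ n ih =>
    obtain ⟨X', hX', hgood, hcard⟩ | ⟨Y', hY', hgood, hcard⟩ := hsplit X subset_rfl Y subset_rfl
    · refine insert_rows hmono (ih (fun X₁ hX₁ => hsplit X₁ (hX₁.trans Finset.sdiff_subset)) ?_)
        hgood
      rw [Finset.card_sdiff_of_subset hX']
      exact sub_mul_pred_pow_lt hcard h
    · refine insert_columns hmono (ih (fun X₁ hX₁ Y₁ hY₁ =>
        hsplit X₁ hX₁ Y₁ (hY₁.trans Finset.sdiff_subset)) ?_) hgood
      rw [Finset.card_sdiff_of_subset hY', mul_comm X.card]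
      rw [mul_comm X.card] at h
      exact sub_mul_pred_pow_lt hcard h

end HasGrid

theorem self_le_three_mul_sqrt {x : ℝ} (h : x ≤ 9) : x ≤ 3 * √x := by
  have hsqrt : √x ≤ 3 := Real.sqrt_le_iff.2 ⟨by norm_num, by linarith⟩
  obtain hx | hx := le_total 0 x
  · exact (Real.mul_self_sqrt hx).ge.trans (mul_le_mul_of_nonneg_right hsqrt x.sqrt_nonneg)
  · linarith [x.sqrt_nonneg]

theorem sqrt_half_le {k : ℕ} (hk : 4 ≤ k) : √(((k + 1) / 2 + 1 : ℕ) : ℝ) ≤ 15 / 16 * √k := by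
  have hhalf : (8 : ℝ) * ((k + 1) / 2 + 1 : ℕ) ≤ 7 * k := by
    exact_mod_cast show 8 * ((k + 1) / 2 + 1) ≤ 7 * k by omega
  refine Real.sqrt_le_iff.2 ⟨by positivity, ?_⟩
  rw [mul_pow, Real.sq_sqrt k.cast_nonneg]
  linarith

namespace RankLE

section Field

variable {A B K Z : Type*} [Field K] {M : A → B → K} {X X' : Finset A} {Y Y' : Finset B} {k : ℕ}

theorem of_empty (h : X = ∅ ∨ Y = ∅) : RankLE M X Y k :=
  ⟨0, 0, by obtain rfl | rfl := h <;> simp⟩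

theorem half_of_constant_rectangle {c : K} (h : RankLE M X Y k) (hX : X' ⊆ X) (hY : Y' ⊆ Y)
    (hc : ∀ i ∈ X', ∀ j ∈ Y', M i j = c) :
    RankLE M X' Y ((k + 1) / 2 + 1) ∨ RankLE M X Y' ((k + 1) / 2 + 1) := by
  obtain ⟨k₁, k₂, hk, h₁, h₂⟩ := (h.affine 1 (-c)).split_of_zero hX hY
    fun i hi j hj => by rw [hc i hi j hj]; ring
  obtain hle | hle := le_total k₁ k₂
  · exact .inl (((h₁.affine 1 c).congr fun i _ j _ => by ring).of_le (by omega))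
  · exact .inr (((h₂.affine 1 c).congr fun i _ j _ => by ring).of_le (by omega))

variable [Fintype Z] [Nonempty Z] {φ : Z → K} {f : A × B → Z}

theorem exists_column_retract (hφ : φ.Injective) (h : RankLE (fun a b => φ (f (a, b))) X Y k) :
    ∃ Y' ⊆ Y, Y'.card ≤ Fintype.card Z ^ k ∧
      ∃ σ : B → B, ∀ b ∈ Y, σ b ∈ Y' ∧ ∀ a ∈ X, f (a, σ b) = f (a, b) := by
  classical
  obtain ⟨I, -, hIcard, hrows⟩ := h.exists_rows
  let column (b : B) (i : I) : Z := f (i, b)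
  obtain ⟨Y', hY', hbij⟩ := Set.exists_subset_bijOn (Y : Set B) column
  lift Y' to Finset B using Y.finite_toSet.subset hY'
  have hrep : ∀ b ∈ Y, ∃ b' ∈ Y', column b' = column b := fun b hb =>
    hbij.surjOn (Set.mem_image_of_mem column hb)
  choose! σ hσ hcolumn using hrep
  refine ⟨Y', by exact_mod_cast hY', ?_, σ, fun b hb => ⟨hσ b hb, fun a ha => hφ ?_⟩⟩
  · calc Y'.card = (Y'.image column).card := (Finset.card_image_of_injOn hbij.injOn).symm
      _ ≤ Fintype.card (I → Z) := Finset.card_le_univ _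
      _ = Fintype.card Z ^ I.card := by simp
      _ ≤ Fintype.card Z ^ k := Nat.pow_le_pow_right Fintype.card_pos hIcard
  · obtain ⟨c, hc⟩ := hrows a ha
    rw [hc _ (hY' (hσ b hb)), hc b hb]
    exact Finset.sum_congr rfl fun i hi =>
      congrArg (fun z => c i * φ z) (congrFun (hcolumn b hb) ⟨i, hi⟩)

theorem solvableOn_of_small {c : ℕ} (hφ : φ.Injective)
    (h : RankLE (fun a b => φ (f (a, b))) X Y k)
    (hsolve : ∀ X' ⊆ X, ∀ Y' ⊆ Y, X'.card ≤ Fintype.card Z ^ k → Y'.card ≤ Fintype.card Z ^ k →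
      SolvableOn f X' Y' c) : SolvableOn f X Y c := by
  obtain ⟨Y', hY', hYcard, σ, hσ⟩ := h.exists_column_retract hφ
  obtain ⟨X', hX', hXcard, ρ, hρ⟩ :=
    exists_column_retract (f := f ∘ Prod.swap) hφ h.transpose
  refine (hsolve X' hX' Y' hY' hXcard hYcard).of_retract ρ σ (fun a ha => (hρ a ha).1)
    (fun b hb => (hσ b hb).1) fun a ha b hb => ?_
  exact ((hρ a ha).2 _ (hY' (hσ b hb).1)).trans ((hσ b hb).2 a ha)

theorem solvableOn {d : ℕ} (hZ : Fintype.card Z ≤ 2 ^ d) (hφ : φ.Injective)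
    (h : RankLE (fun a b => φ (f (a, b))) X Y k) : SolvableOn f X Y (2 * (d * k)) := by
  have hcard : Fintype.card Z ^ k ≤ 2 ^ (d * k) := by
    rw [pow_mul]
    exact Nat.pow_le_pow_left hZ k
  rw [two_mul]
  exact h.solvableOn_of_small hφ fun X' _ Y' _ hX hY =>
    .of_card (hX.trans hcard) (hY.trans hcard)

end Field

section ValueMatrix

variable {A B : Type*} {Δ : ℕ} {f : A × B → Fin (Δ + 1)} {X : Finset A} {Y : Finset B} {k lam : ℕ}

theorem exists_dense_half_rank (hΔ : 0 < Δ) (hlam : 0 < lam) (hk : k + 1 ≤ 2 ^ lam)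
    (h : RankLE (valueMatrix f) X Y k) :
    (∃ X' ⊆ X, RankLE (valueMatrix f) X' Y ((k + 1) / 2 + 1) ∧
        X.card ≤ 2 ^ (120 * (Δ ^ 2 * lam) * (k.sqrt + 1)) * X'.card) ∨
      ∃ Y' ⊆ Y, RankLE (valueMatrix f) X Y' ((k + 1) / 2 + 1) ∧
        Y.card ≤ 2 ^ (120 * (Δ ^ 2 * lam) * (k.sqrt + 1)) * Y'.card := by
  obtain rfl | hX := X.eq_empty_or_nonempty
  · exact .inl ⟨∅, subset_rfl, of_empty (.inl rfl), by simp⟩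
  obtain rfl | hY := Y.eq_empty_or_nonempty
  · exact .inr ⟨∅, subset_rfl, of_empty (.inr rfl), by simp⟩
  obtain ⟨X', hX', Y', hY', ⟨c, hc⟩, hcard⟩ :=
    exists_constant_rectangle (f := fun a b => (f (a, b) : ℕ)) hΔ k.sqrt.succ_pos hlam
      (Nat.lt_succ_sqrt' k).le hk h fun a _ b _ => (f (a, b)).is_le
  obtain hhalf | hhalf := h.half_of_constant_rectangle hX' hY' (c := (c : ℝ))
    fun a ha b hb => congrArg Nat.cast (hc a ha b hb)
  · refine .inl ⟨X', hX', hhalf, Nat.le_of_mul_le_mul_right ?_ hY.card_pos⟩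
    rw [mul_assoc]
    exact hcard.trans (by gcongr)
  · refine .inr ⟨Y', hY', hhalf, Nat.le_of_mul_le_mul_left ?_ hX.card_pos⟩
    rw [mul_left_comm]
    exact hcard.trans (by gcongr)

theorem hasGrid_half_rank (hΔ : 0 < Δ) (hlam : 0 < lam) (hk₀ : 0 < k) (hk : k + 1 ≤ 2 ^ lam)
    (h : RankLE (valueMatrix f) X Y k) (hcard : X.card * Y.card ≤ 2 ^ (2 * (Δ * k))) :
    HasGrid (fun X' Y' => RankLE (valueMatrix f) X' Y' ((k + 1) / 2 + 1))
      (2 ^ (120 * (Δ ^ 2 * lam) * (k.sqrt + 1)) * (2 * (Δ * k))) X Y :=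
  HasGrid.of_dense_split (fun hX hY h => h.mono hX hY) of_empty
    (fun _ hX _ hY => exists_dense_half_rank hΔ hlam hk (h.mono hX hY))
    (mul_pred_pow_lt (by positivity) (by positivity) hcard)

theorem solvableOn_of_half_rank (hΔ : 0 < Δ) (hlam : 0 < lam) (hk₀ : 0 < k)
    (hk : k + 1 ≤ 2 ^ lam) (h : RankLE (valueMatrix f) X Y k) {c : ℕ}
    (hsolve : ∀ (X' : Finset A) (Y' : Finset B),
      RankLE (valueMatrix f) X' Y' ((k + 1) / 2 + 1) → SolvableOn f X' Y' c) :
    SolvableOn f X Y (c + 250 * (Δ ^ 2 * lam * (k.sqrt + 1))) := by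
  refine h.solvableOn_of_small (Nat.cast_injective.comp Fin.val_injective)
    fun X' hX' Y' hY' hX'card hY'card => ?_
  have hvalues : Fintype.card (Fin (Δ + 1)) ^ k ≤ 2 ^ (Δ * k) := by
    rw [Fintype.card_fin, pow_mul]
    exact Nat.pow_le_pow_left Nat.lt_two_pow_self k
  obtain ⟨s, t, hs, ht, hgood⟩ := (h.mono hX' hY').hasGrid_half_rank hΔ hlam hk₀ hk <| by
    rw [two_mul, pow_add]
    exact Nat.mul_le_mul (hX'card.trans hvalues) (hY'card.trans hvalues)
  have hlabels : 2 ^ (120 * (Δ ^ 2 * lam) * (k.sqrt + 1)) * (2 * (Δ * k)) <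
      2 ^ (120 * (Δ ^ 2 * lam) * (k.sqrt + 1) + (1 + Δ + lam)) := by
    rw [pow_add, pow_add _ _ lam, pow_add, pow_one, mul_assoc 2]
    gcongr
    · exact Nat.lt_two_pow_self
    · omega
  refine (SolvableOn.both_send s t (fun a ha => (hs a ha).trans_lt hlabels)
    (fun b hb => (ht b hb).trans_lt hlabels)
    fun i j => hsolve _ _ (hgood i j)).mono subset_rfl subset_rfl ?_
  have hone : 1 ≤ Δ ^ 2 * lam * (k.sqrt + 1) := Nat.mul_pos (by positivity) k.sqrt.succ_pos
  have hΔle : Δ ≤ Δ ^ 2 * lam * (k.sqrt + 1) := by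
    rw [sq, mul_assoc, mul_assoc]
    exact Nat.le_mul_of_pos_right _ (by positivity)
  have hlamle : lam ≤ Δ ^ 2 * lam * (k.sqrt + 1) := by
    rw [mul_comm (Δ ^ 2), mul_assoc]
    exact Nat.le_mul_of_pos_right _ (by positivity)
  linarith

theorem solvableOn_floor_sqrt (hΔ : 0 < Δ) (hlam : 0 < lam) (hk : k + 1 ≤ 2 ^ lam)
    (h : RankLE (valueMatrix f) X Y k) : SolvableOn f X Y ⌊8000 * (Δ ^ 2 * lam) * √(k : ℝ)⌋₊ := by
  induction k using Nat.strong_induction_on generalizing X Y with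
  | _ k ih =>
  obtain hk4 | hk4 := Nat.lt_or_ge k 4
  · refine (h.solvableOn (Z := Fin (Δ + 1)) (by simpa using Nat.lt_two_pow_self)
      (Nat.cast_injective.comp Fin.val_injective)).mono subset_rfl subset_rfl (Nat.le_floor ?_)
    have hΔle : (Δ : ℝ) ≤ Δ ^ 2 * lam := by
      exact_mod_cast show Δ ≤ Δ ^ 2 * lam by
        rw [sq, mul_assoc]
        exact Nat.le_mul_of_pos_right _ (Nat.mul_pos hΔ hlam)
    push_cast
    calc (2 : ℝ) * (Δ * k) ≤ 2 * ((Δ ^ 2 * lam) * (3 * √k)) := by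
          gcongr
          exact self_le_three_mul_sqrt (by exact_mod_cast hk4.le.trans (by norm_num))
      _ = 6 * (Δ ^ 2 * lam) * √k := by ring
      _ ≤ 8000 * (Δ ^ 2 * lam) * √k := by gcongr; norm_num
  · refine (h.solvableOn_of_half_rank hΔ hlam (by omega) hk fun X' Y' h' =>
      ih _ (by omega) (by omega) h').mono subset_rfl subset_rfl (Nat.le_floor ?_)
    have hsqrt : 1 ≤ √(k : ℝ) := Real.one_le_sqrt.2 (by exact_mod_cast le_trans (by norm_num) hk4)
    have hsqrt_nat : (k.sqrt : ℝ) + 1 ≤ 2 * √k := by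
      linarith [Real.nat_sqrt_le_real_sqrt (a := k)]
    have hround : ((250 * (Δ ^ 2 * lam * (k.sqrt + 1)) : ℕ) : ℝ) ≤
        250 * (Δ ^ 2 * lam * (2 * √k)) := by
      push_cast
      gcongr
    have hrest : (⌊8000 * (Δ ^ 2 * lam) * √(((k + 1) / 2 + 1 : ℕ) : ℝ)⌋₊ : ℝ) ≤
        8000 * (Δ ^ 2 * lam) * (15 / 16 * √k) :=
      (Nat.floor_le (by positivity)).trans (by gcongr; exact sqrt_half_le hk4)
    rw [Nat.cast_add]
    linarith

end ValueMatrix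

end RankLE

theorem natLog_succ_le_log (r : ℕ) : (Nat.log 2 r + 1 : ℕ) ≤ 4 * Real.log (max (r : ℝ) 2) := by
  set L := Real.log (max (r : ℝ) 2)
  have hpow : (2 : ℝ) ^ Nat.log 2 r ≤ max (r : ℝ) 2 := by
    obtain rfl | hr := eq_or_ne r 0
    · simp
    · exact le_max_of_le_left (by exact_mod_cast Nat.pow_log_le_self 2 hr)
  have hlog : Nat.log 2 r * Real.log 2 ≤ L := by
    rw [← Real.log_pow]
    exact Real.log_le_log (by positivity) hpow
  have htwo : Real.log 2 ≤ L := Real.log_le_log two_pos (le_max_right _ _)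
  have hhalf : 1 / 2 ≤ Real.log 2 := by linarith [Real.log_two_gt_d9]
  push_cast
  nlinarith [(Nat.log 2 r).cast_nonneg (α := ℝ)]

theorem cast_sq_le_cast_pow_mul (n : ℕ) {c : ℕ} (hc : 2 ≤ c) : (n : ℝ) ^ 2 ≤ (n : ℝ) ^ (c * n) := by
  obtain rfl | hn := n.eq_zero_or_pos
  · norm_num
  · exact pow_le_pow_right₀ (by exact_mod_cast hn) (hc.trans (Nat.le_mul_of_pos_right c hn))

theorem mainTheorem1_general {A B : Type*} [Fintype A] [Fintype B] {Δ : ℕ}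
    (f : A × B → Fin (Δ + 1)) :
    ∃ p : CommProtocol A B (Fin (Δ + 1)), p.Computes f ∧
      (p.length : ℝ) ≤ 32000 * (Δ : ℝ) ^ 2 * √((valueMatrix f).rank : ℝ) *
        Real.log (max ((valueMatrix f).rank : ℝ) 2) := by
  set r := (valueMatrix f).rank
  obtain rfl | hΔ := Δ.eq_zero_or_pos
  · refine ⟨.output 0, fun a b => Fin.ext (by omega), ?_⟩
    simp [CommProtocol.length, CommProtocol.bits]
  obtain ⟨p, hp⟩ := (RankLE.of_rank (valueMatrix f) .univ .univ).solvableOn_floor_sqrt hΔ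
    (Nat.log 2 r).succ_pos (Nat.lt_pow_succ_log_self one_lt_two r)
  simp only [Finset.mem_univ, true_imp_iff] at hp
  refine ⟨p, fun a b => (hp a b).1, ?_⟩
  calc (p.length : ℝ) ≤ 8000 * (Δ ^ 2 * (Nat.log 2 r + 1 : ℕ)) * √r :=
        (Nat.le_floor_iff (by positivity)).1 (Finset.sup_le fun x _ => (hp x.1 x.2).2)
    _ ≤ 8000 * (Δ ^ 2 * (4 * Real.log (max (r : ℝ) 2))) * √r := by
        gcongr
        exact natLog_succ_le_log r
    _ = _ := by ring

/-- There is an absolute constant `C` such that every `f : A × B → {0, 1, …, Δ}` of rank `r` is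
computed by a deterministic protocol of length at most `C · Δ ^ (C Δ) · √r · log (max r 2)`. -/
theorem mainTheorem1 :
    ∃ C : ℕ, ∀ (Δ r : ℕ) (A : Type*) (B : Type*) [Fintype A] [Fintype B]
      (f : A × B → Fin (Δ + 1)), (valueMatrix f).rank = r →
        ∃ p : CommProtocol A B (Fin (Δ + 1)), p.Computes f ∧
          (p.length : ℝ) ≤ (C : ℝ) * (Δ : ℝ) ^ (C * Δ) * √(r : ℝ) * Real.log (max (r : ℝ) 2) := by
  refine ⟨32000, fun Δ r A B _ _ f hr => ?_⟩
  subst hr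
  obtain ⟨p, hp, hlength⟩ := mainTheorem1_general f
  refine ⟨p, hp, hlength.trans ?_⟩
  have hlog : 0 ≤ Real.log (max ((valueMatrix f).rank : ℝ) 2) :=
    Real.log_nonneg (le_max_of_le_right one_le_two)
  rw [Nat.cast_ofNat]
  gcongr ?_ * _ * _
  exact mul_le_mul_of_nonneg_left (cast_sq_le_cast_pow_mul Δ (by norm_num)) (by norm_num)
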